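/- For $n\ge 0$ let $\mathfrak S_n$ be the symmetric group on $[n]=\{1,\dots,n\}$. Given $\alpha=(\alpha_1,\dots,\alpha_n)\in[n]^n$, cars $1,\dots,n$ arrive in this order on a one-way street with spots $1,\dots,n$, and car $i$ parks in the first unoccupied spot $s_i\ge\alpha_i$, if there is one. Then $\alpha$ is a \emph{parking function} if all cars park, and a \emph{unit interval parking function} if moreover $s_i\le\alpha_i+1$ for all $i$. Let $\mathrm{PF}_n$ and $\mathrm{UPF}_n$ be the sets of parking functions and of unit interval parking functions of length $n$ (for $n=0$ both consist of the empty word). For $\alpha\in\mathrm{UPF}_n$ with weakly increasing rearrangement $\beta$, let $i_1<\dots<i_k$ be the positions $i$ with $\beta_i=i$; the \emph{blocks} of $\alpha$ are the words $\pi_j=\beta_{i_j}\beta_{i_j+1}\cdots\beta_{i_{j+1}-1}$ (with $i_{k+1}=n+1$). Let $\Lambda$ be the ring of symmetric functions in $x_1,x_2,\dots$ over $\mathbb C$, with elementary, complete homogeneous and power sum symmetric functions $e_k,h_k,p_k$, and put $E(z)=\sum_{n\ge0}e_nz^n$, $H(z)=\sum_{n\ge0}h_nz^n$ in $\Lambda[[z]]$.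 For a finite-dimensional complex representation $V$ of $\mathfrak S_n$ with character $\chi$, let $\mathrm{ch}(V)=\frac1{n!}\sum_{\sigma\in\mathfrak S_n}\chi(\sigma)\,p_{\mathrm{cyc}(\sigma)}$, where $p_{\mathrm{cyc}(\sigma)}$ is the product of $p_m$ over the lengths $m$ of all cycles of $\sigma$, including fixed points. For a finite set $X$ with an $\mathfrak S_n$-action, $\mathbb C[X]$ denotes the associated permutation module. \textbf{Theorem.} For every $n\ge0$, the rule $$\sigma\cdot\alpha=(\alpha_{\sigma^{-1}(1)},\dots,\alpha_{\sigma^{-1}(n)})$$ defines an action of $\mathfrak S_n$ on $\mathrm{PF}_n$, and there is an action of $\mathfrak S_n$ on $\mathrm{UPF}_n$ in which, for $1\le i\le n-1$, the transposition $(i,i+1)$ fixes $\alpha$ if $\alpha_i$ and $\alpha_{i+1}$ are in the same block of $\alpha$, and exchanges the entries $\alpha_i$ and $\alpha_{i+1}$ of $\alpha$ otherwise (these transpositions generate $\mathfrak S_n$, so this determines the action). For the permutation modules $\mathbb C[\mathrm{PF}_n]$ and $\mathbb C[\mathrm{UPF}_n]$ of these actions, $$\sum_{n\ge0}\mathrm{ch}\,\mathbb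 C[\mathrm{PF}_n]\,z^{n+1}=\bigl(zE(-z)\bigr)^{\langle-1\rangle}\qquad\text{and}\qquad\sum_{n\ge0}\mathrm{ch}\,\mathbb C[\mathrm{UPF}_n]\,z^n=\frac1{2-H(z)}$$ in $\Lambda[[z]]$, where $F(z)^{\langle-1\rangle}$ denotes the compositional inverse of $F(z)$. -/

import Mathlib

open Equiv (Perm)
open PowerSeries (X)

noncomputable section

/-! ### Parking functions

Spots and cars are both indexed by `Fin n`, so that the preference lists in `[n]^n` are the
functions `Fin n → Fin n`, with all indices and values shifted from `1, …, n` to `0, …, n - 1`. -/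

/-- The cars `0, 1, …, n - 1` arrive in this order, and car `i` parks in spot `s i`, the first spot
at or after its preference `α i` that is not taken by an earlier car.  (For given `α`, there is at
most one such `s`, and there is none exactly when some car cannot park.) -/
def ParksAt {n : ℕ} (α s : Fin n → Fin n) : Prop :=
  ∀ i, IsLeast {t : Fin n | α i ≤ t ∧ ∀ j < i, s j ≠ t} (s i)

/-- A parking function: a preference list for which all cars are able to park. -/
def IsParkingFunction {n : ℕ} (α : Fin n → Fin n) : Prop :=
  ∃ s, ParksAt α s

/-- A unit interval parking function: all cars park, and each car parks in its preferred spot or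
in the next one. -/
def IsUnitIntervalParkingFunction {n : ℕ} (α : Fin n → Fin n) : Prop :=
  ∃ s, ParksAt α s ∧ ∀ i, (s i : ℕ) ≤ (α i : ℕ) + 1

/-- The set `PF_n`. -/
abbrev PF (n : ℕ) : Type := {α : Fin n → Fin n // IsParkingFunction α}

/-- The set `UPF_n`. -/
abbrev UPF (n : ℕ) : Type := {α : Fin n → Fin n // IsUnitIntervalParkingFunction α}

/-! ### The actions of the symmetric group -/

/-- The action on `PF_n` given by
`σ • α = (α (σ⁻¹ 1), …, α (σ⁻¹ n))`. -/
def IsPlaceAction {n : ℕ} (act : MulAction (Perm (Fin n)) (PF n)) : Prop :=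
  ∀ (σ : Perm (Fin n)) (α : PF n), (act.smul σ α).1 = fun i => α.1 (σ⁻¹ i)

/-- The weakly increasing rearrangement of `α`. -/
def sortedWord {n : ℕ} (α : Fin n → Fin n) : Fin n → Fin n :=
  α ∘ Tuple.sort α

/-- A new block of the weakly increasing rearrangement `β` of `α` starts at each position `l` with
`β l = l`.  This is the number of the block that contains position `k` of `β`. -/
def blockNumber {n : ℕ} (α : Fin n → Fin n) (k : Fin n) : ℕ :=
  (Finset.univ.filter fun l : Fin n => l ≤ k ∧ sortedWord α l = l).card

/-- The values `x` and `y` appear in the same block of `α`. -/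
def SameBlock {n : ℕ} (α : Fin n → Fin n) (x y : Fin n) : Prop :=
  ∃ k l : Fin n, sortedWord α k = x ∧ sortedWord α l = y ∧ blockNumber α k = blockNumber α l

open Classical in
/-- The action on `UPF_n` for which an adjacent transposition `(i, i + 1)` fixes `α` if `α i` and
`α (i + 1)` are in the same block, and otherwise exchanges these two entries.  (As adjacent
transpositions generate the symmetric group, at most one action has this property.) -/
def IsBlockAction {n : ℕ} (act : MulAction (Perm (Fin n)) (UPF n)) : Prop :=
  ∀ (i j : Fin n), (j : ℕ) = (i : ℕ) + 1 → ∀ α : UPF n,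
    (act.smul (Equiv.swap i j) α).1 =
      if SameBlock α.1 (α.1 i) (α.1 j) then α.1 else α.1 ∘ Equiv.swap i j

/-- The permutation module `ℂ[X]` of an action of the symmetric group on `X`. -/
def permModule {n : ℕ} {X : Type} (act : MulAction (Perm (Fin n)) X) :
    Representation ℂ (Perm (Fin n)) (MonoidAlgebra ℂ X) :=
  letI := act
  Representation.ofMulAction ℂ (Perm (Fin n)) X

/-! ### Symmetric functions -/

/-- A formal power series in `x_0, x_1, …` that is invariant under all permutations of the
variables. -/
def SymmInvariant (f : MvPowerSeries ℕ ℂ) : Prop :=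
  ∀ (σ : Perm ℕ) (d : ℕ →₀ ℕ), MvPowerSeries.coeff (d.mapDomain σ) f = MvPowerSeries.coeff d f

/-- A formal power series all of whose monomials have degree at most some `N`. -/
def BoundedDegree (f : MvPowerSeries ℕ ℂ) : Prop :=
  ∃ N : ℕ, ∀ d : ℕ →₀ ℕ, N < d.degree → MvPowerSeries.coeff d f = 0

theorem SymmInvariant.mul {f g : MvPowerSeries ℕ ℂ} (hf : SymmInvariant f)
    (hg : SymmInvariant g) : SymmInvariant (f * g) := by
  classical
  intro σ d
  rw [MvPowerSeries.coeff_mul, MvPowerSeries.coeff_mul]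
  have hinv : ∀ e : ℕ →₀ ℕ, (e.mapDomain σ).mapDomain σ.symm = e := fun e => by
    rw [← Finsupp.mapDomain_comp]; simp
  have hinv' : ∀ e : ℕ →₀ ℕ, (e.mapDomain σ.symm).mapDomain σ = e := fun e => by
    rw [← Finsupp.mapDomain_comp]; simp
  symm
  refine Finset.sum_bij' (fun p _ => (p.1.mapDomain σ, p.2.mapDomain σ))
    (fun p _ => (p.1.mapDomain σ.symm, p.2.mapDomain σ.symm)) ?_ ?_ ?_ ?_ ?_
  · intro p hp
    rw [Finset.HasAntidiagonal.mem_antidiagonal] at hp ⊢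
    rw [← Finsupp.mapDomain_add, hp]
  · intro p hp
    rw [Finset.HasAntidiagonal.mem_antidiagonal] at hp ⊢
    rw [← Finsupp.mapDomain_add, hp, hinv]
  · intro p _
    simp only [hinv]
  · intro p _
    simp only [hinv']
  · intro p _
    rw [hf, hg]

theorem BoundedDegree.mul {f g : MvPowerSeries ℕ ℂ} (hf : BoundedDegree f)
    (hg : BoundedDegree g) : BoundedDegree (f * g) := by
  classical
  obtain ⟨M, hM⟩ := hf
  obtain ⟨N, hN⟩ := hg
  refine ⟨M + N, fun d hd => ?_⟩
  rw [MvPowerSeries.coeff_mul]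
  refine Finset.sum_eq_zero fun p hp => ?_
  rw [Finset.HasAntidiagonal.mem_antidiagonal] at hp
  rw [← hp, map_add] at hd
  by_cases h : M < p.1.degree
  · rw [hM _ h, zero_mul]
  · rw [hN _ (by omega), mul_zero]

/-- The ring `Λ` of symmetric functions with complex coefficients: the power series in
`x_0, x_1, …` of bounded degree that are invariant under all permutations of the variables. -/
def SymmFunc : Subalgebra ℂ (MvPowerSeries ℕ ℂ) where
  carrier := {f | SymmInvariant f ∧ BoundedDegree f}
  mul_mem' hf hg := ⟨hf.1.mul hg.1, hf.2.mul hg.2⟩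
  add_mem' := by
    rintro f g ⟨hf, M, hM⟩ ⟨hg, N, hN⟩
    refine ⟨fun σ d => by rw [map_add, map_add, hf, hg], max M N, fun d hd => ?_⟩
    rw [map_add, hM _ (lt_of_le_of_lt (le_max_left _ _) hd),
      hN _ (lt_of_le_of_lt (le_max_right _ _) hd), add_zero]
  algebraMap_mem' c := by
    classical
    refine ⟨fun σ d => ?_, 0, fun d hd => ?_⟩
    · rw [MvPowerSeries.algebraMap_apply, MvPowerSeries.coeff_C, MvPowerSeries.coeff_C]
      have h : d.mapDomain σ = 0 ↔ d = 0 := by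
        rw [← Finsupp.mapDomain_zero (f := σ)]
        exact (Finsupp.mapDomain_injective σ.injective).eq_iff
      simp only [h]
    · rw [MvPowerSeries.algebraMap_apply, MvPowerSeries.coeff_C, if_neg]
      rintro rfl
      simp at hd

open Classical in
/-- The sum of all monomials `x^d` whose exponent `d` lies in `S`, for a set `S` of exponents that
is stable under permutations of the variables and bounded in degree. -/
def monomialSum (S : Set (ℕ →₀ ℕ)) (hS : ∀ (σ : Perm ℕ) (d : ℕ →₀ ℕ), d.mapDomain σ ∈ S ↔ d ∈ S)
    (k : ℕ) (hk : ∀ d ∈ S, d.degree = k) : SymmFunc :=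
  ⟨fun d => if d ∈ S then 1 else 0, by
    constructor
    · intro σ d
      change (if d.mapDomain σ ∈ S then (1 : ℂ) else 0) = if d ∈ S then 1 else 0
      simp only [hS]
    · refine ⟨k, fun d hd => ?_⟩
      change (if d ∈ S then (1 : ℂ) else 0) = 0
      exact if_neg fun h => hd.ne' (hk d h)⟩

theorem degree_mapDomain_perm (σ : Perm ℕ) (d : ℕ →₀ ℕ) :
    (d.mapDomain σ).degree = d.degree := by
  simpa [Finsupp.degree_apply, Finsupp.sum] using
    Finsupp.sum_mapDomain_index (f := σ) (s := d) (h := fun _ m => m) (by simp) (by simp)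

/-- The elementary symmetric function `e_k`, the sum of all squarefree monomials of degree `k`. -/
def elemSymm (k : ℕ) : SymmFunc :=
  monomialSum {d | d.degree = k ∧ ∀ i, d i ≤ 1} (fun σ d => by
    simp only [Set.mem_ofPred_eq, degree_mapDomain_perm]
    refine and_congr_right fun _ => ⟨fun h i => ?_, fun h i => ?_⟩
    · have := h (σ i)
      rwa [Finsupp.mapDomain_apply σ.injective] at this
    · have := h (σ.symm i)
      rwa [← Finsupp.mapDomain_apply σ.injective, Equiv.apply_symm_apply] at this)
    k (fun _ h => h.1)

/-- The complete homogeneous symmetric function `h_k`, the sum of all monomials of degree `k`. -/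
def completeSymm (k : ℕ) : SymmFunc :=
  monomialSum {d | d.degree = k}
    (fun σ d => by simp only [Set.mem_ofPred_eq, degree_mapDomain_perm]) k (fun _ h => h)

/-- The power sum symmetric function `p_k = ∑ x_i ^ k` for `k ≥ 1`, with `p_0 = 1`: the sum of all
distinct monomials of the form `x_i ^ k`. -/
def powerSum (k : ℕ) : SymmFunc :=
  monomialSum {d | ∃ i, d = Finsupp.single i k} (fun σ d => by
    simp only [Set.mem_ofPred_eq]
    constructor
    · rintro ⟨i, h⟩
      refine ⟨σ.symm i, Finsupp.mapDomain_injective σ.injective ?_⟩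
      rw [h, Finsupp.mapDomain_single, Equiv.apply_symm_apply]
    · rintro ⟨i, rfl⟩
      exact ⟨σ i, Finsupp.mapDomain_single⟩)
    k (by rintro _ ⟨i, rfl⟩; simp)

/-! ### The Frobenius characteristic -/

/-- `p_{cyc(σ)}`, the product of the `p_m` over the lengths `m` of the cycles of `σ`, with fixed
points counted as cycles of length `1`. -/
def powerSumCycleType {n : ℕ} (σ : Perm (Fin n)) : SymmFunc :=
  (σ.partition.parts.map powerSum).prod

/-- The Frobenius characteristic `ch V = (1 / n!) ∑ χ(σ) p_{cyc(σ)}`, where `χ` is the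
character of the representation `V` of the symmetric group. -/
def frobeniusChar {n : ℕ} {V : Type} [AddCommGroup V] [Module ℂ V]
    (ρ : Representation ℂ (Perm (Fin n)) V) : SymmFunc :=
  (1 / (n.factorial : ℂ)) • ∑ σ : Perm (Fin n), ρ.character σ • powerSumCycleType σ

/-! ### Generating functions -/

/-- `E(z) = ∑ e_n z^n`. -/
def genE : PowerSeries SymmFunc := PowerSeries.mk elemSymm

/-- `H(z) = ∑ h_n z^n`. -/
def genH : PowerSeries SymmFunc := PowerSeries.mk completeSymm

/-- `Q` is the compositional inverse of `P`: both have no constant term, `P(Q(z)) = z` and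
`Q(P(z)) = z`. -/
def IsCompInverse {R : Type} [CommRing R] (P Q : PowerSeries R) : Prop :=
  P.constantCoeff = 0 ∧ Q.constantCoeff = 0 ∧
    PowerSeries.subst Q P = (X : PowerSeries R) ∧ PowerSeries.subst P Q = (X : PowerSeries R)

end

/-! Both identities are proved monomial by monomial, each coefficient being a number of orbits. The
character of a permutation module counts fixed points, and the coefficient of `x^d` in `p_{cyc(σ)}`
counts the words with exponent `d` fixed by `σ` (`coeff_powerSumCycleType`). By Burnside's lemma,
the coefficient of `x^d` in the characteristic of `ℂ[A]` is therefore the number of orbits of `𝔖_n`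
on pairs (element of `A`, word with exponent `d`). If the elements of `A` are themselves encoded
equivariantly as words `f`, an orbit of pairs `(f, w)` is the same as an `ExponentSeq`, whose term
at `v` is the content of `w` on the positions where `f` equals `v`; this is
`coeff_frobeniusChar_permModule`.

For parking functions, `f` is the preference list itself. The counting criterion
`isParkingFunction_iff` says that the degrees of the terms, each diminished by one, are the steps of
a walk that starts at `1` and reaches `0` for the first time after `n + 1` steps. On the other side,
let `Q` be the inverse of `z E(-z)`. Since `H(z) E(-z) = 1`, it satisfies `Q = z H(Q)`, hence
`Q^(k+1) = z H(Q) Q^k`. As `H` has every monomial with coefficient `1`, this is the recursion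
obtained by splitting off the first step of a walk from `k + 1`, so the coefficients of `Q^k` count
first passages from `k` (`hasCount_isFirstPassage`).

For unit interval parking functions, `f` records the block of each car. The order inside a block is
forced to be the order of arrival, so these functions correspond to ordered set partitions
(`weakOrderEquiv`), and under this bijection the block action becomes the place action. The
sequences that occur are those without gaps. Splitting off the nonzero first term of such a sequence
gives `U = 1 + (H - 1) U` for their generating function, that is, `(2 - H) U = 1`. -/

noncomputable section

/-! ### Graded power series over the symmetric functions -/

/-- The coefficient of `z ^ n` in `F` is homogeneous of degree `n`, and the coefficients of its
monomials are given by `a`. -/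
def HasGradedCoeff (F : PowerSeries SymmFunc) (a : (ℕ →₀ ℕ) → ℂ) : Prop :=
  ∀ n d, MvPowerSeries.coeff d (PowerSeries.coeff n F).1 = if d.degree = n then a d else 0

theorem HasGradedCoeff.unique {F G : PowerSeries SymmFunc} {a : (ℕ →₀ ℕ) → ℂ}
    (hF : HasGradedCoeff F a) (hG : HasGradedCoeff G a) : F = G := by
  ext n : 1
  apply Subtype.ext
  ext d
  rw [hF, hG]

theorem SymmFunc.coeff_mul (f g : SymmFunc) (d : ℕ →₀ ℕ) :
    MvPowerSeries.coeff d (f * g).1 = ∑ p ∈ Finset.HasAntidiagonal.antidiagonal d,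
      MvPowerSeries.coeff p.1 f.1 * MvPowerSeries.coeff p.2 g.1 :=
  MvPowerSeries.coeff_mul d f.1 g.1

theorem SymmFunc.coeff_sum {ι : Type*} (s : Finset ι) (f : ι → SymmFunc) (d : ℕ →₀ ℕ) :
    MvPowerSeries.coeff d (∑ i ∈ s, f i).1 = ∑ i ∈ s, MvPowerSeries.coeff d (f i).1 := by
  rw [AddSubmonoidClass.coe_finsetSum, map_sum]

/-- The power of `z` is determined by the degree of the monomial, so each splitting `d = p.1 + p.2`
meets exactly one pair of coefficients of `F` and `G`. -/
theorem HasGradedCoeff.mul {F G : PowerSeries SymmFunc} {a b : (ℕ →₀ ℕ) → ℂ}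
    (hF : HasGradedCoeff F a) (hG : HasGradedCoeff G b) :
    HasGradedCoeff (F * G) fun d => ∑ p ∈ Finset.HasAntidiagonal.antidiagonal d, a p.1 * b p.2 := by
  intro n d
  rw [PowerSeries.coeff_mul, SymmFunc.coeff_sum]
  simp only [SymmFunc.coeff_mul, hF _ _, hG _ _]
  rw [Finset.sum_comm]
  split_ifs with h
  · refine Finset.sum_congr rfl fun p hp => ?_
    rw [Finset.HasAntidiagonal.mem_antidiagonal] at hp
    rw [Finset.sum_eq_single (p.1.degree, p.2.degree)]
    · simp
    · rintro ⟨i, j⟩ - hij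
      by_cases h1 : p.1.degree = i
      · by_cases h2 : p.2.degree = j
        · simp [h1, h2] at hij
        · simp [h2]
      · simp [h1]
    · intro hnot
      refine absurd ?_ hnot
      rw [Finset.HasAntidiagonal.mem_antidiagonal, ← map_add, hp, h]
  · refine Finset.sum_eq_zero fun p hp => Finset.sum_eq_zero fun q hq => ?_
    rw [Finset.HasAntidiagonal.mem_antidiagonal] at hp hq
    by_cases h1 : p.1.degree = q.1
    · by_cases h2 : p.2.degree = q.2
      · refine absurd ?_ h
        rw [← hp, map_add, h1, h2, hq]
      · simp [h2]
    · simp [h1]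

theorem HasGradedCoeff.sub {F G : PowerSeries SymmFunc} {a b : (ℕ →₀ ℕ) → ℂ}
    (hF : HasGradedCoeff F a) (hG : HasGradedCoeff G b) :
    HasGradedCoeff (F - G) fun d => a d - b d := by
  intro n d
  have h : MvPowerSeries.coeff d (PowerSeries.coeff n (F - G)).1 =
      MvPowerSeries.coeff d (PowerSeries.coeff n F).1 -
        MvPowerSeries.coeff d (PowerSeries.coeff n G).1 := by
    rw [map_sub, AddSubgroupClass.coe_sub, map_sub]
  rw [h, hF, hG]
  split_ifs <;> simp

theorem HasGradedCoeff.add {F G : PowerSeries SymmFunc} {a b : (ℕ →₀ ℕ) → ℂ}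
    (hF : HasGradedCoeff F a) (hG : HasGradedCoeff G b) :
    HasGradedCoeff (F + G) fun d => a d + b d := by
  intro n d
  have h : MvPowerSeries.coeff d (PowerSeries.coeff n (F + G)).1 =
      MvPowerSeries.coeff d (PowerSeries.coeff n F).1 +
        MvPowerSeries.coeff d (PowerSeries.coeff n G).1 := by
    rw [map_add, AddMemClass.coe_add, map_add]
  rw [h, hF, hG]
  split_ifs <;> simp

theorem hasGradedCoeff_one : HasGradedCoeff 1 fun d => if d = 0 then 1 else 0 := by
  classical
  intro n d
  rw [PowerSeries.coeff_one]
  by_cases hn : n = 0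
  · subst hn
    rw [if_pos rfl, OneMemClass.coe_one, MvPowerSeries.coeff_one]
    by_cases hd : d = 0
    · simp [hd]
    · simp [hd]
  · rw [if_neg hn, ZeroMemClass.coe_zero, map_zero]
    by_cases hd : d = 0
    · subst hd
      rw [if_neg (by simpa using Ne.symm hn)]
    · simp [hd]

/-! ### Coefficients of `H(z)` and `E(-z)`, and `H(z) E(-z) = 1` -/

theorem coeff_monomialSum (S : Set (ℕ →₀ ℕ))
    (hS : ∀ (σ : Perm ℕ) (d : ℕ →₀ ℕ), d.mapDomain σ ∈ S ↔ d ∈ S) (k : ℕ)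
    (hk : ∀ d ∈ S, d.degree = k) (d : ℕ →₀ ℕ) [Decidable (d ∈ S)] :
    MvPowerSeries.coeff d (monomialSum S hS k hk).1 = if d ∈ S then 1 else 0 := by
  have h : MvPowerSeries.coeff d (monomialSum S hS k hk).1 =
    @ite ℂ (d ∈ S) (Classical.propDecidable _) 1 0 := rfl
  rw [h]
  by_cases hd : d ∈ S <;> simp only [hd, if_true, if_false]

theorem coeff_completeSymm (k : ℕ) (d : ℕ →₀ ℕ) :
    MvPowerSeries.coeff d (completeSymm k).1 = if d.degree = k then 1 else 0 := by
  rw [completeSymm, coeff_monomialSum]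
  exact if_congr Iff.rfl rfl rfl

theorem hasGradedCoeff_genH : HasGradedCoeff genH fun _ => 1 := by
  intro n d
  rw [genH, PowerSeries.coeff_mk, coeff_completeSymm]

theorem coeff_elemSymm (k : ℕ) (d : ℕ →₀ ℕ) [Decidable (∀ i, d i ≤ 1)] :
    MvPowerSeries.coeff d (elemSymm k).1 = if d.degree = k ∧ ∀ i, d i ≤ 1 then 1 else 0 := by
  rw [elemSymm, coeff_monomialSum]
  exact if_congr Iff.rfl rfl rfl

open Classical in
theorem hasGradedCoeff_rescale_genE :
    HasGradedCoeff (PowerSeries.rescale (-1) genE)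
      fun d => if ∀ i, d i ≤ 1 then (-1) ^ d.degree else 0 := by
  intro n d
  have h : MvPowerSeries.coeff d (PowerSeries.coeff n (PowerSeries.rescale (-1) genE)).1 =
      (-1) ^ n * MvPowerSeries.coeff d (elemSymm n).1 := by
    rw [PowerSeries.coeff_rescale, genE, PowerSeries.coeff_mk]
    rcases neg_one_pow_eq_or SymmFunc n with h | h <;>
      rcases neg_one_pow_eq_or ℂ n with h' | h'
    · simp [h, h']
    · rcases Nat.even_or_odd n with hn | hn
      · rw [hn.neg_one_pow] at h'
        norm_num at h'
      · simp [hn.neg_one_pow]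
    · rcases Nat.even_or_odd n with hn | hn
      · simp [hn.neg_one_pow]
      · rw [hn.neg_one_pow] at h'
        exact absurd h' (by norm_num)
    · simp [h, h']
  rw [h, coeff_elemSymm]
  by_cases h1 : d.degree = n
  · by_cases h2 : ∀ i, d i ≤ 1
    · rw [if_pos ⟨h1, h2⟩, if_pos h1, mul_one, ← h1]
      exact (if_pos h2).symm
    · rw [if_neg fun h => h2 h.2, if_pos h1, mul_zero]
      exact (if_neg h2).symm
  · rw [if_neg fun h => h1 h.1, if_neg h1, mul_zero]

open Classical in
theorem sum_antidiagonal_squarefree (d : ℕ →₀ ℕ) :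
    ∑ p ∈ Finset.HasAntidiagonal.antidiagonal d,
      (1 : ℂ) * (if ∀ i, p.2 i ≤ 1 then (-1) ^ p.2.degree else 0) =
      if d = 0 then 1 else 0 := by
  -- A squarefree exponent below `d` is the indicator of a subset of the support of `d`, so the sum
  -- is the alternating sum over all these subsets.
  have key : ∑ S ∈ d.support.powerset, (-1 : ℂ) ^ S.card = if d = 0 then 1 else 0 := by
    have := congrArg (Int.cast : ℤ → ℂ) (Finset.sum_powerset_neg_one_pow_card (x := d.support))
    push_cast at this
    simpa [Finsupp.support_eq_empty] using this
  rw [← key]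
  simp only [one_mul]
  rw [← Finset.sum_filter]
  have hdeg : ∀ e : ℕ →₀ ℕ, (∀ i, e i ≤ 1) → e.degree = e.support.card := by
    intro e he
    rw [Finsupp.degree_apply, Finset.card_eq_sum_ones]
    refine Finset.sum_congr rfl fun i hi => ?_
    have := Finsupp.mem_support_iff.1 hi
    have := he i
    omega
  let ind : Finset ℕ → (ℕ →₀ ℕ) := fun S => Finsupp.indicator S fun _ _ => 1
  have hind : ∀ S i, ind S i = if i ∈ S then 1 else 0 := fun S i => by
    simp [ind, Finsupp.indicator_apply]
  refine Finset.sum_bij' (fun p _ => p.2.support) (fun S _ => (d - ind S, ind S)) ?_ ?_ ?_ ?_ ?_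
  · intro p hp
    rw [Finset.mem_filter, Finset.HasAntidiagonal.mem_antidiagonal] at hp
    rw [Finset.mem_powerset, ← hp.1]
    intro i hi
    rw [Finsupp.mem_support_iff] at hi ⊢
    rw [Finsupp.add_apply]
    omega
  · intro S hS
    rw [Finset.mem_powerset] at hS
    rw [Finset.mem_filter, Finset.HasAntidiagonal.mem_antidiagonal]
    refine ⟨?_, fun i => by rw [hind]; split_ifs <;> simp⟩
    ext i
    rw [Finsupp.add_apply, Finsupp.tsub_apply, hind]
    split_ifs with h
    · have := Finsupp.mem_support_iff.1 (hS h)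
      omega
    · omega
  · intro p hp
    rw [Finset.mem_filter, Finset.HasAntidiagonal.mem_antidiagonal] at hp
    have h2 : ind p.2.support = p.2 := by
      ext i
      rw [hind]
      have := hp.2 i
      split_ifs with h
      · have := Finsupp.mem_support_iff.1 h
        omega
      · exact (Finsupp.notMem_support_iff.1 h).symm
    rw [h2]
    refine Prod.ext ?_ rfl
    rw [← hp.1]
    ext i
    simp
  · intro S hS
    ext i
    rw [Finsupp.mem_support_iff, hind]
    simp
  · intro p hp
    rw [Finset.mem_filter] at hp
    rw [hdeg _ hp.2]

theorem genH_mul_rescale_genE : genH * PowerSeries.rescale (-1) genE = 1 := by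
  classical
  have h := hasGradedCoeff_genH.mul hasGradedCoeff_rescale_genE
  simp only [sum_antidiagonal_squarefree] at h
  exact h.unique hasGradedCoeff_one

/-! ### The compositional inverse of `z E(-z)` -/

theorem constantCoeff_rescale_genE :
    PowerSeries.constantCoeff (PowerSeries.rescale (-1) genE) = 1 := by
  rw [← PowerSeries.coeff_zero_eq_constantCoeff_apply, PowerSeries.coeff_rescale, pow_zero, one_mul,
    genE, PowerSeries.coeff_mk]
  classical
  apply Subtype.ext
  ext d
  rw [coeff_elemSymm, OneMemClass.coe_one, MvPowerSeries.coeff_one]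
  congr 1
  rw [Finsupp.degree_eq_zero_iff, eq_iff_iff]
  constructor
  · exact fun h => h.1
  · rintro rfl
    simp

theorem isUnit_coeff_one_X_mul_genE :
    IsUnit (PowerSeries.coeff 1 (X * PowerSeries.rescale (-1) genE)) := by
  rw [← zero_add 1, PowerSeries.coeff_succ_X_mul, PowerSeries.coeff_zero_eq_constantCoeff_apply,
    constantCoeff_rescale_genE]
  exact isUnit_one

/-- The compositional inverse of `z E(-z)`. -/
def inverseSeries : PowerSeries SymmFunc :=
  PowerSeries.substInvOfIsUnit (X * PowerSeries.rescale (-1) genE) isUnit_coeff_one_X_mul_genE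

theorem isCompInverse_inverseSeries :
    IsCompInverse (X * PowerSeries.rescale (-1) genE) inverseSeries :=
  have h0 : (X * PowerSeries.rescale (-1) genE : PowerSeries SymmFunc).constantCoeff = 0 := by
    simp
  ⟨h0, PowerSeries.constantCoeff_substInvOfIsUnit _ _,
    PowerSeries.subst_substInvOfIsUnit_right _ h0 _, PowerSeries.subst_substInvOfIsUnit_left _ h0 _⟩

theorem hasSubst_inverseSeries : PowerSeries.HasSubst inverseSeries :=
  PowerSeries.HasSubst.of_constantCoeff_zero' isCompInverse_inverseSeries.2.1

/-- Substituting `Q` into `H(z) E(-z) = 1` and multiplying `Q E(-Q) = z` by `H(Q)` turns the inverse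
relation into a fixed-point equation. -/
theorem inverseSeries_eq : inverseSeries = X * PowerSeries.subst inverseSeries genH := by
  have hQ := hasSubst_inverseSeries
  have h := isCompInverse_inverseSeries.2.2.1
  rw [PowerSeries.subst_mul hQ, PowerSeries.subst_X hQ] at h
  have h1 : PowerSeries.subst inverseSeries genH *
      PowerSeries.subst inverseSeries (PowerSeries.rescale (-1) genE) = 1 := by
    rw [← PowerSeries.subst_mul hQ, genH_mul_rescale_genE, ← PowerSeries.coe_substAlgHom hQ, map_one]
  calc inverseSeries = inverseSeries * (PowerSeries.subst inverseSeries genH *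
      PowerSeries.subst inverseSeries (PowerSeries.rescale (-1) genE)) := by rw [h1, mul_one]
    _ = (inverseSeries * PowerSeries.subst inverseSeries (PowerSeries.rescale (-1) genE)) *
        PowerSeries.subst inverseSeries genH := by ring
    _ = X * PowerSeries.subst inverseSeries genH := by rw [h]

theorem coeff_inverseSeries_pow_eq_zero {n k : ℕ} (h : n < k) :
    PowerSeries.coeff n (inverseSeries ^ k) = 0 := by
  rw [inverseSeries_eq, mul_pow, PowerSeries.coeff_X_pow_mul', if_neg (by omega)]

theorem coeff_succ_inverseSeries_pow_succ (n k : ℕ) :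
    PowerSeries.coeff (n + 1) (inverseSeries ^ (k + 1)) =
      ∑ i ∈ Finset.range (n + 1),
        completeSymm i * PowerSeries.coeff n (inverseSeries ^ (i + k)) := by
  have hQ := hasSubst_inverseSeries
  have h : inverseSeries ^ (k + 1) = X * PowerSeries.subst inverseSeries (genH * X ^ k) := by
    rw [PowerSeries.subst_mul hQ, PowerSeries.subst_pow hQ, PowerSeries.subst_X hQ, ← mul_assoc,
      ← inverseSeries_eq, pow_succ']
  rw [h, PowerSeries.coeff_succ_X_mul, PowerSeries.coeff_subst' hQ,
    finsum_eq_sum_of_support_subset (s := (Finset.range (n + 1)).map (addRightEmbedding k))]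
  · rw [Finset.sum_map]
    refine Finset.sum_congr rfl fun i _ => ?_
    rw [addRightEmbedding_apply, PowerSeries.coeff_mul_X_pow, genH, PowerSeries.coeff_mk,
      smul_eq_mul]
  · intro j hj
    rw [Function.mem_support] at hj
    simp only [Finset.coe_map, addRightEmbedding_apply, Set.mem_image, Finset.coe_range,
      Set.mem_Iio]
    have h1 : k ≤ j := by
      by_contra hlt
      exact hj (by rw [PowerSeries.coeff_mul_X_pow', if_neg hlt, zero_smul])
    have h2 : j ≤ n := by
      by_contra hlt
      exact hj (by rw [coeff_inverseSeries_pow_eq_zero (by omega), smul_zero])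
    exact ⟨j - k, by omega, by omega⟩

/-- In `Q^(k+1) = z H(Q) Q^k`, every monomial of `h_i` has coefficient `1`, and the exponent `p.1`
determines `i` as its degree. Terms with `i > n` vanish because `Q` is divisible by `z`. The result
has the form of the first-step recursion for walks. -/
theorem coeff_coeff_succ_inverseSeries_pow_succ (n k : ℕ) (d : ℕ →₀ ℕ) :
    MvPowerSeries.coeff d (PowerSeries.coeff (n + 1) (inverseSeries ^ (k + 1))).1 =
      ∑ p ∈ Finset.HasAntidiagonal.antidiagonal d,
        MvPowerSeries.coeff p.2 (PowerSeries.coeff n (inverseSeries ^ (p.1.degree + k))).1 := by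
  rw [coeff_succ_inverseSeries_pow_succ, SymmFunc.coeff_sum]
  simp only [SymmFunc.coeff_mul, coeff_completeSymm]
  rw [Finset.sum_comm]
  refine Finset.sum_congr rfl fun p _ => ?_
  simp only [ite_mul, one_mul, zero_mul]
  rw [Finset.sum_ite_eq]
  split_ifs with h
  · rfl
  · rw [Finset.mem_range] at h
    rw [coeff_inverseSeries_pow_eq_zero (by omega), ZeroMemClass.coe_zero, map_zero]

/-! ### Sequences of exponents -/

/-- Finitely supported sequences of exponents of monomials.  They describe the orbits of the
symmetric group on words of pairs of natural numbers. -/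
abbrev ExponentSeq : Type := ℕ →₀ (ℕ →₀ ℕ)

namespace ExponentSeq

/-- The sum of all terms of the sequence. -/
def total (E : ExponentSeq) : ℕ →₀ ℕ := E.sum fun _ e => e

/-- The sequence without its first term. -/
def tail (E : ExponentSeq) : ExponentSeq := E.comapDomain Nat.succ Nat.succ_injective.injOn

/-- The sequence with a new first term. -/
def cons (e : ℕ →₀ ℕ) (E : ExponentSeq) : ExponentSeq :=
  Finsupp.single 0 e + E.mapDomain Nat.succ

@[simp]
theorem tail_apply (E : ExponentSeq) (v : ℕ) : tail E v = E (v + 1) := rfl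

@[simp]
theorem cons_zero (e : ℕ →₀ ℕ) (E : ExponentSeq) : cons e E 0 = e := by
  rw [cons, Finsupp.add_apply, Finsupp.single_eq_same, Finsupp.mapDomain_of_notMem_range, add_zero]
  simp

@[simp]
theorem cons_succ (e : ℕ →₀ ℕ) (E : ExponentSeq) (v : ℕ) : cons e E (v + 1) = E v := by
  rw [cons, Finsupp.add_apply, Finsupp.single_eq_of_ne (by omega), zero_add]
  exact Finsupp.mapDomain_apply Nat.succ_injective E v

@[simp]
theorem tail_cons (e : ℕ →₀ ℕ) (E : ExponentSeq) : tail (cons e E) = E := by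
  ext v : 1
  simp

@[simp]
theorem cons_tail (E : ExponentSeq) : cons (E 0) (tail E) = E := by
  ext v : 1
  cases v <;> simp

theorem total_cons (e : ℕ →₀ ℕ) (E : ExponentSeq) : total (cons e E) = e + total E := by
  rw [total, cons, Finsupp.sum_add_index' (fun _ => rfl) (fun _ _ _ => rfl),
    Finsupp.sum_single_index rfl, Finsupp.sum_mapDomain_index (fun _ => rfl) (fun _ _ _ => rfl)]
  rfl

theorem total_eq (E : ExponentSeq) : total E = E 0 + total (tail E) := by
  rw [← total_cons, cons_tail]

theorem le_total (E : ExponentSeq) (v : ℕ) : E v ≤ total E := by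
  by_cases h : v ∈ E.support
  · exact Finset.single_le_sum (f := fun v => E v) (fun _ _ => zero_le) h
  · rw [Finsupp.notMem_support_iff.1 h]
    exact zero_le

theorem total_eq_zero_iff {E : ExponentSeq} : total E = 0 ↔ E = 0 := by
  constructor
  · intro h
    ext v : 1
    exact le_antisymm ((le_total E v).trans_eq h) zero_le
  · rintro rfl
    exact Finsupp.sum_zero_index

/-- There are exactly `N` sequences with the property `p`. -/
def HasCount (p : ExponentSeq → Prop) (N : ℂ) : Prop :=
  ∃ s : Finset ExponentSeq, (∀ E, E ∈ s ↔ p E) ∧ (s.card : ℂ) = N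

theorem HasCount.unique {p : ExponentSeq → Prop} {M N : ℂ} (hM : HasCount p M)
    (hN : HasCount p N) : M = N := by
  obtain ⟨s, hs, rfl⟩ := hM
  obtain ⟨t, ht, rfl⟩ := hN
  rw [show s = t from Finset.ext fun E => by rw [hs, ht]]

theorem HasCount.congr {p q : ExponentSeq → Prop} {N : ℂ} (hp : HasCount p N)
    (h : ∀ E, p E ↔ q E) : HasCount q N := by
  rwa [← show p = q from funext fun E => propext (h E)]

theorem hasCount_false {p : ExponentSeq → Prop} (h : ∀ E, ¬ p E) : HasCount p 0 :=
  ⟨∅, fun E => by simp [h], by simp⟩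

theorem hasCount_eq (E₀ : ExponentSeq) : HasCount (fun E => E = E₀) 1 :=
  ⟨{E₀}, fun E => by simp, by simp⟩

/-- The tool for all recursions on sequences: a sequence is its first term together with its tail,
and injectivity of `g` keeps the cases `a ∈ A` disjoint. -/
theorem HasCount.cons {ι : Type*} {A : Finset ι} {g : ι → ℕ →₀ ℕ} (hg : Set.InjOn g A)
    {q : ι → ExponentSeq → Prop} {N : ι → ℂ} (h : ∀ a ∈ A, HasCount (q a) (N a)) :
    HasCount (fun E => ∃ a ∈ A, E 0 = g a ∧ q a (tail E)) (∑ a ∈ A, N a) := by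
  classical
  have h' : ∀ a, ∃ s : Finset ExponentSeq, a ∈ A → (∀ E, E ∈ s ↔ q a E) ∧ (s.card : ℂ) = N a := by
    intro a
    by_cases ha : a ∈ A
    · obtain ⟨s, hs⟩ := h a ha
      exact ⟨s, fun _ => hs⟩
    · exact ⟨∅, fun h => absurd h ha⟩
  choose s hs using h'
  refine ⟨A.biUnion fun a => (s a).image (ExponentSeq.cons (g a)), fun E => ?_, ?_⟩
  · simp only [Finset.mem_biUnion, Finset.mem_image]
    constructor
    · rintro ⟨a, ha, E', hE', rfl⟩
      exact ⟨a, ha, cons_zero _ _, by rw [tail_cons]; exact ((hs a ha).1 E').1 hE'⟩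
    · rintro ⟨a, ha, h0, hq⟩
      exact ⟨a, ha, tail E, ((hs a ha).1 _).2 hq, by rw [← h0, cons_tail]⟩
  · rw [Finset.card_biUnion, Nat.cast_sum]
    · refine Finset.sum_congr rfl fun a ha => ?_
      rw [Finset.card_image_of_injective, (hs a ha).2]
      intro E E' hEE'
      rw [← tail_cons (g a) E, hEE', tail_cons]
    · intro a ha b hb hab
      rw [Function.onFun, Finset.disjoint_left]
      intro E hEa hEb
      rw [Finset.mem_image] at hEa hEb
      obtain ⟨E₁, -, rfl⟩ := hEa
      obtain ⟨E₂, -, h2⟩ := hEb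
      refine hab (hg ha hb ?_)
      rw [← cons_zero (g a) E₁, ← h2, cons_zero]

theorem injOn_fst_antidiagonal (d : ℕ →₀ ℕ) :
    Set.InjOn Prod.fst (Finset.HasAntidiagonal.antidiagonal d : Set ((ℕ →₀ ℕ) × (ℕ →₀ ℕ))) := by
  intro p hp q hq h
  rw [Finset.mem_coe, Finset.HasAntidiagonal.mem_antidiagonal] at hp hq
  refine Prod.ext h ?_
  rw [h, ← hq] at hp
  exact add_left_cancel hp

/-- Sequences without gaps: after a vanishing term, all terms vanish. -/
def IsGapless (E : ExponentSeq) : Prop := ∀ v, E (v + 1) ≠ 0 → E v ≠ 0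

theorem isGapless_iff_of_ne_zero {E : ExponentSeq} (hE : E ≠ 0) :
    IsGapless E ↔ E 0 ≠ 0 ∧ IsGapless (tail E) := by
  constructor
  · refine fun h => ⟨fun h0 => hE ?_, fun v => h (v + 1)⟩
    ext v : 1
    induction v with
    | zero => exact h0
    | succ v ih => exact by_contra fun hv => h v hv ih
  · rintro ⟨h0, h⟩ (_ | v) hv
    · exact h0
    · exact h v hv

/-- The number of gapless sequences with a given total. -/
theorem exists_hasCount_isGapless :
    ∃ N : (ℕ →₀ ℕ) → ℂ, (∀ d, HasCount (fun E => total E = d ∧ IsGapless E) (N d)) ∧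
      N 0 = 1 ∧ ∀ d ≠ 0, 2 * N d = ∑ p ∈ Finset.HasAntidiagonal.antidiagonal d, N p.2 := by
  classical
  have hrec : ∀ d : ℕ →₀ ℕ, d ≠ 0 → ∀ E : ExponentSeq,
      (∃ p ∈ (Finset.HasAntidiagonal.antidiagonal d).filter (fun p => p.1 ≠ 0),
        E 0 = p.1 ∧ (total (tail E) = p.2 ∧ IsGapless (tail E))) ↔
      (total E = d ∧ IsGapless E) := by
    intro d hd E
    simp only [Finset.mem_filter, Finset.HasAntidiagonal.mem_antidiagonal]
    constructor
    · rintro ⟨p, ⟨hp, hp0⟩, h0, h1, h2⟩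
      have ht : total E = d := by rw [total_eq, h0, h1, hp]
      have hE : E ≠ 0 := fun h => hd (by rw [← ht, total_eq_zero_iff.2 h])
      exact ⟨ht, (isGapless_iff_of_ne_zero hE).2 ⟨h0 ▸ hp0, h2⟩⟩
    · rintro ⟨ht, hg⟩
      have hE : E ≠ 0 := fun h => hd (by rw [← ht, total_eq_zero_iff.2 h])
      rw [isGapless_iff_of_ne_zero hE] at hg
      exact ⟨(E 0, total (tail E)), ⟨by rw [← total_eq, ht], hg.1⟩, rfl, rfl, hg.2⟩
  have hinj : ∀ d : ℕ →₀ ℕ, Set.InjOn Prod.fst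
      ((Finset.HasAntidiagonal.antidiagonal d).filter (fun p => p.1 ≠ 0) :
        Set ((ℕ →₀ ℕ) × (ℕ →₀ ℕ))) := fun d =>
    (injOn_fst_antidiagonal d).mono (by exact_mod_cast Finset.filter_subset _ _)
  have hzero : HasCount (fun E => total E = 0 ∧ IsGapless E) 1 := by
    refine (hasCount_eq 0).congr fun E => ⟨?_, fun h => total_eq_zero_iff.1 h.1⟩
    rintro rfl
    exact ⟨total_eq_zero_iff.2 rfl, fun v hv => absurd rfl hv⟩
  have hex : ∀ (n : ℕ) (d : ℕ →₀ ℕ), d.degree = n →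
      ∃ N, HasCount (fun E => total E = d ∧ IsGapless E) N := by
    -- The tail left after removing a nonzero first term has a total of smaller degree.
    intro n
    induction n using Nat.strong_induction_on with
    | _ n ih =>
      intro d hd
      by_cases h0 : d = 0
      · subst h0
        exact ⟨1, hzero⟩
      · have h : ∀ p : (ℕ →₀ ℕ) × (ℕ →₀ ℕ), ∃ N,
            p ∈ (Finset.HasAntidiagonal.antidiagonal d).filter (fun p => p.1 ≠ 0) →
              HasCount (fun E => total E = p.2 ∧ IsGapless E) N := by
          intro p
          by_cases hp : p ∈ (Finset.HasAntidiagonal.antidiagonal d).filter (fun p => p.1 ≠ 0)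
          · rw [Finset.mem_filter, Finset.HasAntidiagonal.mem_antidiagonal] at hp
            have h1 : p.1.degree ≠ 0 := fun h => hp.2 ((Finsupp.degree_eq_zero_iff _).1 h)
            have h2 : p.1.degree + p.2.degree = n := by rw [← map_add, hp.1, hd]
            obtain ⟨N, hN⟩ := ih p.2.degree (by omega) p.2 rfl
            exact ⟨N, fun _ => hN⟩
          · exact ⟨0, fun h => absurd h hp⟩
        choose N hN using h
        exact ⟨_, (HasCount.cons (hinj d) hN).congr (hrec d h0)⟩
  have hex' : ∀ d : ℕ →₀ ℕ, ∃ N, HasCount (fun E => total E = d ∧ IsGapless E) N :=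
    fun d => hex _ d rfl
  choose N hN using hex'
  refine ⟨N, hN, (hN 0).unique hzero, fun d hd => ?_⟩
  have h := (hN d).unique ((HasCount.cons (hinj d) fun p _ => hN p.2).congr (hrec d hd))
  -- The recursion runs over `p.1 ≠ 0`; the missing term `p = (0, d)` contributes a second copy of
  -- `N d`.
  rw [← Finset.sum_filter_add_sum_filter_not _ (fun p : (ℕ →₀ ℕ) × (ℕ →₀ ℕ) => p.1 ≠ 0), ← h,
    two_mul]
  congr 1
  rw [Finset.sum_eq_single (0, d)]
  · intro p hp hne
    rw [Finset.mem_filter, Finset.HasAntidiagonal.mem_antidiagonal, not_not] at hp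
    refine absurd (Prod.ext hp.2 ?_) hne
    rw [← hp.1, hp.2, zero_add]
  · intro hnot
    refine absurd ?_ hnot
    simp

/-- Starting with `k` and adding the degrees of the terms, each diminished by `1`, one reaches `0`
after `n` steps for the first time. -/
def IsFirstPassage (n k : ℕ) (E : ExponentSeq) : Prop :=
  (∀ m < n, m < k + ∑ v ∈ Finset.range m, (E v).degree) ∧ (total E).degree + k = n

theorem not_isFirstPassage_succ_zero (n : ℕ) (E : ExponentSeq) : ¬ IsFirstPassage (n + 1) 0 E :=
  fun h => by simpa using h.1 0 n.succ_pos

/-- After its first step the walk continues from `(k + 1) + (E 0).degree - 1`. -/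
theorem isFirstPassage_succ_succ (n k : ℕ) (E : ExponentSeq) :
    IsFirstPassage (n + 1) (k + 1) E ↔ IsFirstPassage n ((E 0).degree + k) (tail E) := by
  have h : (total E).degree = (E 0).degree + (total (tail E)).degree := by
    rw [total_eq, map_add]
  constructor
  · rintro ⟨h1, h2⟩
    refine ⟨fun m hm => ?_, by omega⟩
    have := h1 (m + 1) (by omega)
    rw [Finset.sum_range_succ'] at this
    simp only [tail_apply]
    omega
  · rintro ⟨h1, h2⟩
    refine ⟨fun m hm => ?_, by omega⟩
    cases m with
    | zero => omega
    | succ m =>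
      have := h1 m (by omega)
      rw [Finset.sum_range_succ']
      simp only [tail_apply] at this
      omega

/-- Induction on `n`: removing the first term changes `k + 1` into `(E 0).degree + k`, exactly as in
`coeff_coeff_succ_inverseSeries_pow_succ`. -/
theorem hasCount_isFirstPassage (n k : ℕ) (d : ℕ →₀ ℕ) :
    HasCount (fun E => total E = d ∧ IsFirstPassage n k E)
      (MvPowerSeries.coeff d (PowerSeries.coeff n (inverseSeries ^ k)).1) := by
  induction n generalizing k d with
  | zero =>
    by_cases hk : k = 0
    · subst hk
      rw [pow_zero, hasGradedCoeff_one]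
      by_cases hd : d = 0
      · subst hd
        simp only [map_zero, if_true]
        refine (hasCount_eq 0).congr fun E => ⟨?_, fun h => total_eq_zero_iff.1 h.1⟩
        rintro rfl
        exact ⟨total_eq_zero_iff.2 rfl, fun m hm => absurd hm (Nat.not_lt_zero m),
          by rw [total_eq_zero_iff.2 rfl, map_zero]⟩
      · simp only [if_neg hd, ite_self]
        refine hasCount_false fun E h => hd ?_
        rw [← Finsupp.degree_eq_zero_iff, ← h.1]
        have := h.2.2
        omega
    · rw [coeff_inverseSeries_pow_eq_zero (Nat.pos_of_ne_zero hk), ZeroMemClass.coe_zero, map_zero]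
      refine hasCount_false fun E h => hk ?_
      have := h.2.2
      omega
  | succ n ih =>
    cases k with
    | zero =>
      rw [pow_zero, PowerSeries.coeff_one, if_neg n.succ_ne_zero, ZeroMemClass.coe_zero, map_zero]
      exact hasCount_false fun E h => not_isFirstPassage_succ_zero n E h.2
    | succ k =>
      rw [coeff_coeff_succ_inverseSeries_pow_succ]
      refine (HasCount.cons (injOn_fst_antidiagonal d)
        fun p _ => ih (p.1.degree + k) p.2).congr fun E => ?_
      rw [isFirstPassage_succ_succ]
      constructor
      · rintro ⟨p, hp, h0, ht, h⟩
        rw [Finset.HasAntidiagonal.mem_antidiagonal] at hp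
        exact ⟨by rw [total_eq, h0, ht, hp], h0 ▸ h⟩
      · rintro ⟨ht, h⟩
        refine ⟨(E 0, total (tail E)), ?_, rfl, rfl, h⟩
        rw [Finset.HasAntidiagonal.mem_antidiagonal, ← total_eq, ht]

end ExponentSeq

/-! ### Permutation characters -/

theorem character_ofMulAction {G H : Type} [Group G] [MulAction G H] [Finite H] (g : G) :
    (Representation.ofMulAction ℂ G H).character g = Nat.card (MulAction.fixedBy H g) := by
  classical
  have := Fintype.ofFinite H
  rw [Representation.character, LinearMap.trace_eq_matrix_trace ℂ (MonoidAlgebra.basis H ℂ),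
    Matrix.trace]
  have h : ∀ x, (LinearMap.toMatrix (MonoidAlgebra.basis H ℂ) (MonoidAlgebra.basis H ℂ)
      (Representation.ofMulAction ℂ G H g)).diag x = if g • x = x then 1 else 0 := by
    intro x
    rw [Matrix.diag_apply, LinearMap.toMatrix_apply]
    simp [MonoidAlgebra.basis, Finsupp.single_apply]
  simp only [h]
  rw [Finset.sum_boole, Nat.card_eq_fintype_card, Fintype.card_subtype]
  rfl

/-! ### Power sums and words -/

theorem coeff_powerSum (k : ℕ) (d : ℕ →₀ ℕ) [Decidable (∃ i, d = Finsupp.single i k)] :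
    MvPowerSeries.coeff d (powerSum k).1 = if ∃ i, d = Finsupp.single i k then 1 else 0 := by
  classical
  rw [powerSum, coeff_monomialSum]
  exact if_congr Iff.rfl rfl rfl

/-- Expanding the product means choosing a variable `v i` from each factor. For `m i = 0` the
monomial would not determine the variable, hence the hypothesis `hm`. -/
theorem coeff_prod_powerSum {I : Type} [Fintype I] (m : I → ℕ) (hm : ∀ i, m i ≠ 0)
    (d : ℕ →₀ ℕ) :
    MvPowerSeries.coeff d (∏ i, powerSum (m i)).1 =
      Nat.card {v : I → ℕ // ∑ i, Finsupp.single (v i) (m i) = d} := by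
  classical
  have h : (∏ i, powerSum (m i)).1 = ∏ i, (powerSum (m i)).1 :=
    map_prod SymmFunc.val _ _
  have hterm : ∀ l : I →₀ (ℕ →₀ ℕ), ∏ i, MvPowerSeries.coeff (l i) (powerSum (m i)).1 =
      if ∀ i, ∃ a, l i = Finsupp.single a (m i) then 1 else 0 := by
    intro l
    split_ifs with hl
    · exact Finset.prod_eq_one fun i _ => by rw [coeff_powerSum, if_pos (hl i)]
    · obtain ⟨i, hi⟩ := not_forall.1 hl
      exact Finset.prod_eq_zero (Finset.mem_univ i) (by rw [coeff_powerSum, if_neg hi])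
  rw [h, MvPowerSeries.coeff_prod, Finset.sum_congr rfl fun l _ => hterm l, Finset.sum_boole]
  rw [Nat.cast_inj, ← Fintype.card_coe, ← Nat.card_eq_fintype_card]
  symm
  refine Nat.card_eq_of_bijective (fun v => ⟨Finsupp.equivFunOnFinite.symm
    fun i => Finsupp.single (v.1 i) (m i), ?_⟩) ⟨?_, ?_⟩
  · rw [Finset.mem_filter, Finset.mem_finsuppAntidiag]
    exact ⟨⟨v.2, Finset.subset_univ _⟩, fun i => ⟨v.1 i, rfl⟩⟩
  · intro v v' hv
    apply Subtype.ext
    funext i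
    have := DFunLike.congr_fun (Subtype.ext_iff.1 hv) i
    exact Finsupp.single_left_injective (hm i) this
  · rintro ⟨l, hl⟩
    rw [Finset.mem_filter, Finset.mem_finsuppAntidiag] at hl
    choose v hv using hl.2
    refine ⟨⟨v, ?_⟩, ?_⟩
    · rw [← hl.1.1]
      exact Finset.sum_congr rfl fun i _ => (hv i).symm
    · apply Subtype.ext
      ext i : 1
      exact (hv i).symm

/-- The cycles of a permutation, with their lengths. -/
theorem exists_cycle_map {n : ℕ} (σ : Perm (Fin n)) :
    ∃ (I : Type) (_ : Fintype I) (_ : DecidableEq I) (π : Fin n → I), Function.Surjective π ∧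
      (∀ x y, π x = π y ↔ σ.SameCycle x y) ∧
      σ.partition.parts = Finset.univ.val.map fun i => (Finset.univ.filter (π · = i)).card := by
  classical
  -- `cycleFactorsFinset` omits trivial cycles, so the fixed points are adjoined as a second
  -- summand.
  let π : Fin n → {c // c ∈ σ.cycleFactorsFinset} ⊕ {x // x ∈ Function.fixedPoints σ} := fun x =>
    if h : σ x = x then Sum.inr ⟨x, h⟩ else
      Sum.inl ⟨σ.cycleOf x, Perm.cycleOf_mem_cycleFactorsFinset_iff.2 (Perm.mem_support.2 h)⟩
  have hfix : ∀ (x : Fin n) (h : σ x = x), π x = Sum.inr ⟨x, h⟩ := fun x h => dif_pos h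
  have hcyc : ∀ (x : Fin n) (h : ¬ σ x = x), π x = Sum.inl ⟨σ.cycleOf x,
    Perm.cycleOf_mem_cycleFactorsFinset_iff.2 (Perm.mem_support.2 h)⟩ := fun x h => dif_neg h
  have hinl : ∀ x c, π x = Sum.inl c ↔ x ∈ c.1.support := by
    intro x c
    constructor
    · intro hx
      by_cases h : σ x = x
      · rw [hfix x h] at hx
        cases hx
      · rw [hcyc x h] at hx
        rw [← Sum.inl.inj hx, Perm.mem_support_cycleOf_iff]
        exact ⟨Perm.SameCycle.refl _ _, Perm.mem_support.2 h⟩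
    · intro hx
      have hx' : x ∈ σ.support := Perm.mem_cycleFactorsFinset_support_le c.2 hx
      rw [hcyc x (Perm.mem_support.1 hx')]
      exact congrArg Sum.inl (Subtype.ext (Perm.cycle_is_cycleOf hx c.2).symm)
  have hinr : ∀ x y, π x = Sum.inr y ↔ x = y.1 := by
    intro x y
    constructor
    · intro hx
      by_cases h : σ x = x
      · rw [hfix x h] at hx
        rw [← Sum.inr.inj hx]
      · rw [hcyc x h] at hx
        cases hx
    · rintro rfl
      exact hfix _ y.2
  refine ⟨_, inferInstance, inferInstance, π, ?_, ?_, ?_⟩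
  · rintro (c | y)
    · have hc := (Perm.mem_cycleFactorsFinset_iff.1 c.2).1.nonempty_support
      obtain ⟨x, hx⟩ := hc
      exact ⟨x, (hinl x c).2 hx⟩
    · exact ⟨y.1, (hinr _ y).2 rfl⟩
  · intro x y
    by_cases h : σ y = y
    · rw [hfix y h, hinr]
      constructor
      · rintro rfl
        exact Perm.SameCycle.refl _ _
      · intro hxy
        exact (hxy.symm.eq_of_left h).symm
    · rw [hcyc y h, hinl, Perm.mem_support_cycleOf_iff' h]
      exact ⟨Perm.SameCycle.symm, Perm.SameCycle.symm⟩
  · rw [Perm.parts_partition, Perm.cycleType_def, ← Finset.univ_disjSum_univ,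
      Finset.val_disjSum, Multiset.disjSum, Multiset.map_add, Multiset.map_map, Multiset.map_map]
    congr 1
    · rw [← Finset.attach_eq_univ, Finset.attach_val]
      conv_lhs => rw [← Multiset.attach_map_val σ.cycleFactorsFinset.val, Multiset.map_map]
      refine Multiset.map_congr rfl fun c _ => ?_
      simp only [Function.comp_apply]
      congr 1
      ext x
      rw [Finset.mem_filter]
      exact (hinl x ⟨c.1, c.2⟩).symm.trans (by simp)
    · symm
      rw [Multiset.eq_replicate]
      constructor
      · rw [Multiset.card_map, Finset.card_val, Finset.card_univ, ← Finset.card_compl]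
        rw [Fintype.card_subtype]
        congr 1
        ext x
        simp [Function.IsFixedPt]
      · intro b hb
        rw [Multiset.mem_map] at hb
        obtain ⟨y, -, rfl⟩ := hb
        exact Finset.card_eq_one.2 ⟨y.1, by ext x; simp [hinr]⟩

/-- The exponent of the monomial `∏ i, x_{w i}`. -/
def wordExponent {n : ℕ} (w : Fin n → ℕ) : ℕ →₀ ℕ := ∑ i, Finsupp.single (w i) 1

theorem wordExponent_comp {n : ℕ} (w : Fin n → ℕ) (σ : Perm (Fin n)) :
    wordExponent (w ∘ σ) = wordExponent w :=
  Equiv.sum_comp σ fun i => Finsupp.single (w i) 1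

theorem apply_eq_of_sameCycle {n : ℕ} {σ : Perm (Fin n)} {w : Fin n → ℕ} (hw : w ∘ σ = w)
    {x y : Fin n} (h : σ.SameCycle x y) : w x = w y := by
  obtain ⟨k, -, -, rfl⟩ := h.exists_pow_eq
  clear h
  induction k with
  | zero => rfl
  | succ k ih =>
    rw [pow_succ', Perm.mul_apply, ih]
    exact (congrFun hw _).symm

/-- A word is fixed by `σ` when it is constant on cycles, and a cycle of length `m` carrying the
letter `v` contributes the factor `x_v^m`, a monomial of `p_m`. -/
theorem coeff_powerSumCycleType {n : ℕ} (σ : Perm (Fin n)) (d : ℕ →₀ ℕ) :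
    MvPowerSeries.coeff d (powerSumCycleType σ).1 =
      Nat.card {w : Fin n → ℕ // w ∘ σ = w ∧ wordExponent w = d} := by
  obtain ⟨I, _, _, π, hsurj, hπ, hparts⟩ := exists_cycle_map σ
  have hprod : powerSumCycleType σ =
      ∏ i, powerSum (Finset.univ.filter (π · = i)).card := by
    rw [powerSumCycleType, hparts, Multiset.map_map]
    rfl
  have hexp : ∀ v : I → ℕ, wordExponent (v ∘ π) =
      ∑ i, Finsupp.single (v i) (Finset.univ.filter (π · = i)).card := by
    intro v
    rw [wordExponent, ← Finset.sum_fiberwise Finset.univ π]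
    refine Finset.sum_congr rfl fun i _ => ?_
    rw [Finset.sum_congr rfl (g := fun _ => Finsupp.single (v i) 1), Finset.sum_const,
      Finsupp.smul_single, smul_eq_mul, mul_one]
    intro x hx
    rw [Function.comp_apply, (Finset.mem_filter.1 hx).2]
  rw [hprod, coeff_prod_powerSum, Nat.cast_inj]
  · refine Nat.card_eq_of_bijective (fun v => ⟨v.1 ∘ π, ?_, ?_⟩) ⟨?_, ?_⟩
    · funext x
      exact congrArg v.1 ((hπ _ _).2 (Perm.SameCycle.refl σ x).apply_left)
    · rw [hexp, v.2]
    · intro v v' h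
      exact Subtype.ext (hsurj.injective_comp_right (Subtype.ext_iff.1 h))
    · rintro ⟨w, hw, hd⟩
      have hwπ : (fun i => w (Function.surjInv hsurj i)) ∘ π = w := by
        funext x
        exact apply_eq_of_sameCycle hw ((hπ _ _).1 (Function.surjInv_eq hsurj (π x)))
      exact ⟨⟨fun i => w (Function.surjInv hsurj i), by rw [← hexp, hwπ, hd]⟩, Subtype.ext hwπ⟩
  · intro i
    obtain ⟨x, hx⟩ := hsurj i
    exact (Finset.card_pos.2 ⟨x, by simp [hx]⟩).ne'

/-! ### Orbits of words -/

namespace ExponentSeq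

/-- The sequence of exponents in which the term with index `v` collects the letters `w i` with
`f i = v`. -/
def ofWords {n : ℕ} (f w : Fin n → ℕ) : ExponentSeq :=
  ∑ i, Finsupp.single (f i) (Finsupp.single (w i) 1)

theorem total_add (E E' : ExponentSeq) : total (E + E') = total E + total E' :=
  Finsupp.sum_add_index' (fun _ => rfl) fun _ _ _ => rfl

theorem total_single (v : ℕ) (e : ℕ →₀ ℕ) : total (Finsupp.single v e) = e :=
  Finsupp.sum_single_index rfl

theorem total_sum {ι : Type*} (s : Finset ι) (E : ι → ExponentSeq) :
    total (∑ i ∈ s, E i) = ∑ i ∈ s, total (E i) :=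
  map_sum (⟨⟨total, total_eq_zero_iff.2 rfl⟩, total_add⟩ : ExponentSeq →+ (ℕ →₀ ℕ)) E s

theorem total_ofWords {n : ℕ} (f w : Fin n → ℕ) : total (ofWords f w) = wordExponent w := by
  simp only [ofWords, total_sum, total_single, wordExponent]

theorem degree_wordExponent {n : ℕ} (w : Fin n → ℕ) : (wordExponent w).degree = n := by
  simp [wordExponent, map_sum]

theorem ofWords_comp {n : ℕ} (f w : Fin n → ℕ) (σ : Perm (Fin n)) :
    ofWords (f ∘ σ) (w ∘ σ) = ofWords f w :=
  Equiv.sum_comp σ fun i => Finsupp.single (f i) (Finsupp.single (w i) 1)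

theorem degree_ofWords_apply {n : ℕ} (f w : Fin n → ℕ) (v : ℕ) :
    (ofWords f w v).degree = (Finset.univ.filter fun i => f i = v).card := by
  rw [ofWords, Finsupp.finsetSum_apply, map_sum, Finset.card_filter]
  refine Finset.sum_congr rfl fun i _ => ?_
  by_cases h : f i = v
  · subst h
    simp
  · rw [Finsupp.single_eq_of_ne (Ne.symm h), if_neg h, map_zero]

theorem ofWords_apply_ne_zero_iff {n : ℕ} (f w : Fin n → ℕ) (v : ℕ) :
    ofWords f w v ≠ 0 ↔ ∃ i, f i = v := by
  rw [ne_eq, ← Finsupp.degree_eq_zero_iff, degree_ofWords_apply, Finset.card_eq_zero,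
    ← ne_eq, ← Finset.nonempty_iff_ne_empty]
  simp [Finset.Nonempty]

theorem ofWords_apply_apply {n : ℕ} (f w : Fin n → ℕ) (a b : ℕ) :
    ofWords f w a b = Fintype.card {i // (f i, w i) = (a, b)} := by
  rw [ofWords, Finsupp.finsetSum_apply, Finsupp.finsetSum_apply, Fintype.card_subtype,
    Finset.card_filter]
  refine Finset.sum_congr rfl fun i _ => ?_
  by_cases h : f i = a
  · subst h
    simp [Finsupp.single_apply]
  · simp [Finsupp.single_eq_of_ne (Ne.symm h), h]

/-- Equal sequences mean that each pair of letters occurs equally often; bijections between the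
fibres glue to a permutation. -/
theorem exists_perm_of_ofWords_eq {n : ℕ} {f w f' w' : Fin n → ℕ}
    (h : ofWords f w = ofWords f' w') : ∃ σ : Perm (Fin n), f' ∘ σ = f ∧ w' ∘ σ = w := by
  have e : ∀ c : ℕ × ℕ, Nonempty ({i // (f i, w i) = c} ≃ {i // (f' i, w' i) = c}) := by
    rintro ⟨a, b⟩
    refine ⟨Fintype.equivOfCardEq ?_⟩
    rw [← ofWords_apply_apply, ← ofWords_apply_apply, h]
  let σ : Perm (Fin n) := Equiv.ofFiberEquiv fun c => (e c).some
  have hσ : ∀ i, (f' (σ i), w' (σ i)) = (f i, w i) := fun i =>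
    Equiv.ofFiberEquiv_map (f := fun i => (f i, w i)) (g := fun i => (f' i, w' i)) _ i
  exact ⟨σ, funext fun i => congrArg Prod.fst (hσ i), funext fun i => congrArg Prod.snd (hσ i)⟩

theorem exists_ofWords_eq {n : ℕ} (E : ExponentSeq) (hE : (total E).degree = n) :
    ∃ f w : Fin n → ℕ, ofWords f w = E := by
  induction n generalizing E with
  | zero =>
    refine ⟨Fin.elim0, Fin.elim0, ?_⟩
    rw [Finsupp.degree_eq_zero_iff, total_eq_zero_iff] at hE
    rw [hE, ofWords, Finset.univ_eq_empty, Finset.sum_empty]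
  | succ n ih =>
    have hne : E ≠ 0 := by
      rintro rfl
      rw [total_eq_zero_iff.2 rfl, map_zero] at hE
      omega
    obtain ⟨a, ha⟩ := Finsupp.ne_iff.1 hne
    obtain ⟨b, hb⟩ := Finsupp.ne_iff.1 ha
    rw [Finsupp.zero_apply, Finsupp.zero_apply] at hb
    have hle : Finsupp.single a (Finsupp.single b 1) ≤ E := by
      intro v
      by_cases hv : v = a
      · subst hv
        rw [Finsupp.single_eq_same, Finsupp.single_le_iff]
        omega
      · rw [Finsupp.single_eq_of_ne hv]
        exact zero_le
    have hadd : Finsupp.single a (Finsupp.single b 1) +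
        (E - Finsupp.single a (Finsupp.single b 1)) = E := add_tsub_cancel_of_le hle
    obtain ⟨f, w, hfw⟩ := ih (E - Finsupp.single a (Finsupp.single b 1)) (by
      have := congrArg (fun E => (total E).degree) hadd
      simp only [total_add, total_single, map_add, Finsupp.degree_single, hE] at this
      omega)
    refine ⟨Fin.cons a f, Fin.cons b w, ?_⟩
    rw [← hadd, ← hfw, ofWords, Fin.sum_univ_succ]
    rfl

end ExponentSeq

open ExponentSeq

/-- The place action on the words with a given exponent. -/
instance wordAction (n : ℕ) (d : ℕ →₀ ℕ) :
    MulAction (Perm (Fin n)) {w : Fin n → ℕ // wordExponent w = d} where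
  smul σ w := ⟨w.1 ∘ ⇑σ⁻¹, by rw [wordExponent_comp, w.2]⟩
  one_smul _ := rfl
  mul_smul σ τ w := Subtype.ext (by
    change w.1 ∘ ⇑(σ * τ)⁻¹ = (w.1 ∘ ⇑τ⁻¹) ∘ ⇑σ⁻¹
    rw [mul_inv_rev]
    rfl)

theorem wordAction_smul {n : ℕ} {d : ℕ →₀ ℕ} (σ : Perm (Fin n))
    (w : {w : Fin n → ℕ // wordExponent w = d}) : (σ • w).1 = w.1 ∘ ⇑σ⁻¹ := rfl

instance finite_wordExponent (n : ℕ) (d : ℕ →₀ ℕ) :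
    Finite {w : Fin n → ℕ // wordExponent w = d} := by
  have h : ∀ w : Fin n → ℕ, wordExponent w = d → ∀ i, w i ∈ d.support := by
    rintro w rfl i
    rw [Finsupp.mem_support_iff, wordExponent, Finsupp.finsetSum_apply]
    refine (Finset.sum_pos' (fun _ _ => Nat.zero_le _) ⟨i, Finset.mem_univ i, ?_⟩).ne'
    rw [Finsupp.single_eq_same]
    exact one_pos
  refine Finite.of_injective (fun w i => (⟨w.1 i, h w.1 w.2 i⟩ : d.support)) fun w w' hw => ?_
  apply Subtype.ext
  funext i
  exact congrArg Subtype.val (congrFun hw i)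

theorem comp_inv_eq_iff {n : ℕ} {B : Type*} (w : Fin n → B) (σ : Perm (Fin n)) :
    w ∘ ⇑σ⁻¹ = w ↔ w ∘ σ = w := by
  constructor <;> intro h
  · conv_lhs => rw [← h]
    funext i
    simp
  · conv_lhs => rw [← h]
    funext i
    simp

theorem coeff_powerSumCycleType_eq_card_fixedBy {n : ℕ} (σ : Perm (Fin n)) (d : ℕ →₀ ℕ) :
    MvPowerSeries.coeff d (powerSumCycleType σ).1 =
      Nat.card (MulAction.fixedBy {w : Fin n → ℕ // wordExponent w = d} σ) := by
  rw [coeff_powerSumCycleType, Nat.cast_inj]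
  refine Nat.card_congr ⟨fun w => ⟨⟨w.1, w.2.2⟩, Subtype.ext ((comp_inv_eq_iff _ _).2 w.2.1)⟩,
    fun w => ⟨w.1.1, (comp_inv_eq_iff _ _).1 (Subtype.ext_iff.1 w.2), w.1.2⟩,
    fun _ => rfl, fun _ => rfl⟩

/-- The coefficients of the Frobenius characteristic of a permutation module count orbits on pairs
of words. -/
theorem coeff_frobeniusChar_permModule {n : ℕ} {A : Type} [Finite A]
    (act : MulAction (Perm (Fin n)) A) (φ : A → Fin n → ℕ) (hφ : Function.Injective φ)
    (hact : ∀ σ x, φ (act.smul σ x) = φ x ∘ ⇑σ⁻¹) (d : ℕ →₀ ℕ) {p : ExponentSeq → Prop} {N : ℂ}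
    (hN : HasCount p N)
    (hp : ∀ E, p E ↔ ∃ x w, wordExponent w = d ∧ ofWords (φ x) w = E) :
    MvPowerSeries.coeff d (frobeniusChar (permModule act)).1 = N := by
  classical
  let := act
  have hact' : ∀ (σ : Perm (Fin n)) (x : A), φ (σ • x) = φ x ∘ ⇑σ⁻¹ := hact
  obtain ⟨s, hs, rfl⟩ := hN
  let W := {w : Fin n → ℕ // wordExponent w = d}
  have := Fintype.ofFinite (Quotient (MulAction.orbitRel (Perm (Fin n)) (A × W)))
  have hfix : ∀ σ : Perm (Fin n), Fintype (MulAction.fixedBy (A × W) σ) := fun σ =>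
    Fintype.ofFinite _
  -- The product of the two fixed-point counts is the fixed-point count on `A × W`.
  have hterm : ∀ σ : Perm (Fin n), (permModule act).character σ *
      MvPowerSeries.coeff d (powerSumCycleType σ).1 =
      (Fintype.card (MulAction.fixedBy (A × W) σ) : ℂ) := by
    intro σ
    have h := character_ofMulAction (G := Perm (Fin n)) (H := A) σ
    change (Representation.ofMulAction ℂ (Perm (Fin n)) A).character σ * _ = _
    rw [h, coeff_powerSumCycleType_eq_card_fixedBy, ← Nat.cast_mul, ← Nat.card_prod,
      Nat.cast_inj, ← Nat.card_eq_fintype_card]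
    exact Nat.card_congr ⟨fun q => ⟨(q.1.1, q.2.1), Prod.ext q.1.2 q.2.2⟩,
      fun q => (⟨q.1.1, congrArg Prod.fst q.2⟩, ⟨q.1.2, congrArg Prod.snd q.2⟩),
      fun _ => rfl, fun _ => rfl⟩
  have hcoeff : MvPowerSeries.coeff d (frobeniusChar (permModule act)).1 =
      (1 / (n.factorial : ℂ)) * ∑ σ : Perm (Fin n), (permModule act).character σ *
        MvPowerSeries.coeff d (powerSumCycleType σ).1 := by
    rw [frobeniusChar, SetLike.val_smul, map_smul, SymmFunc.coeff_sum, smul_eq_mul]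
    refine congrArg _ (Finset.sum_congr rfl fun σ _ => ?_)
    rw [SetLike.val_smul, map_smul, smul_eq_mul]
  -- `ofWords` is a complete invariant of orbits, and `hp` identifies its image.
  have horbits : Fintype.card (Quotient (MulAction.orbitRel (Perm (Fin n)) (A × W))) = s.card := by
    rw [← Fintype.card_coe]
    have hmem : ∀ q : A × W, ofWords (φ q.1) q.2.1 ∈ s := fun q =>
      (hs _).2 ((hp _).2 ⟨q.1, q.2.1, q.2.2, rfl⟩)
    refine Fintype.card_of_bijective (f := Quotient.lift
      (fun q : A × W => (⟨ofWords (φ q.1) q.2.1, hmem q⟩ : s)) ?_) ⟨?_, ?_⟩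
    · rintro q q' ⟨σ, rfl⟩
      apply Subtype.ext
      change ofWords (φ (σ • q'.1)) (σ • q'.2).1 = ofWords (φ q'.1) q'.2.1
      rw [hact', wordAction_smul, ofWords_comp]
    · intro q q'
      induction q using Quotient.inductionOn with | _ q
      induction q' using Quotient.inductionOn with | _ q'
      intro h
      obtain ⟨σ, h1, h2⟩ := exists_perm_of_ofWords_eq (Subtype.ext_iff.1 h)
      refine Quotient.sound ⟨σ⁻¹, Prod.ext (hφ ?_) (Subtype.ext ?_)⟩
      · change φ (σ⁻¹ • q'.1) = _
        rw [hact', inv_inv, h1]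
      · change q'.2.1 ∘ ⇑(σ⁻¹)⁻¹ = _
        rw [inv_inv, h2]
    · rintro ⟨E, hE⟩
      obtain ⟨x, w, hw, rfl⟩ := (hp E).1 ((hs E).1 hE)
      exact ⟨Quotient.mk _ (x, ⟨w, hw⟩), rfl⟩
  -- Burnside's lemma; the order of the group cancels the factor `1 / n!`.
  rw [hcoeff, Finset.sum_congr rfl fun σ _ => hterm σ, ← Nat.cast_sum,
    MulAction.sum_card_fixedBy_eq_card_orbits_mul_card_group, horbits, Fintype.card_perm,
    Fintype.card_fin, Nat.cast_mul]
  have : (n.factorial : ℂ) ≠ 0 := Nat.cast_ne_zero.2 n.factorial_ne_zero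
  field_simp

/-! ### Parking functions -/

theorem ParksAt.injective {n : ℕ} {α s : Fin n → Fin n} (h : ParksAt α s) :
    Function.Injective s := by
  have key : ∀ i j, i < j → s i ≠ s j := fun i j hij => (h j).1.2 i hij
  intro i j hij
  rcases lt_trichotomy i j with hlt | heq | hlt
  · exact absurd hij (key i j hlt)
  · exact heq
  · exact absurd hij.symm (key j i hlt)

theorem ParksAt.surjective {n : ℕ} {α s : Fin n → Fin n} (h : ParksAt α s) :
    Function.Surjective s :=
  Finite.injective_iff_surjective.1 h.injective

theorem ParksAt.le {n : ℕ} {α s : Fin n → Fin n} (h : ParksAt α s) (i : Fin n) : α i ≤ s i :=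
  (h i).1.1

/-- The spot of a car depends only on the spots of the earlier cars. -/
theorem ParksAt.unique {n : ℕ} {α s s' : Fin n → Fin n} (h : ParksAt α s) (h' : ParksAt α s') :
    s = s' := by
  funext i
  induction i using WellFoundedLT.induction with
  | ind i ih =>
    refine (h i).unique ?_
    have hset : {t : Fin n | α i ≤ t ∧ ∀ j < i, s j ≠ t} =
        {t : Fin n | α i ≤ t ∧ ∀ j < i, s' j ≠ t} := by
      ext t
      refine and_congr_right fun _ => forall₂_congr fun j hj => ?_
      rw [ih j hj]
    rw [hset]
    exact h' i

/-- A list of preferences is a parking function when, for all `m`, at least `m` cars prefer one of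
the first `m` spots. -/
theorem isParkingFunction_iff {n : ℕ} (α : Fin n → Fin n) :
    IsParkingFunction α ↔ ∀ m ≤ n, m ≤ (Finset.univ.filter fun i => (α i : ℕ) < m).card := by
  constructor
  · rintro ⟨s, hs⟩ m hm
    let e := Equiv.ofBijective s ⟨hs.injective, hs.surjective⟩
    -- The cars that end up in the first `m` spots also prefer one of these spots.
    have h := Finset.card_le_card_of_injOn (s := (Finset.univ : Finset (Fin m)))
      (t := Finset.univ.filter fun i => (α i : ℕ) < m) (fun t => e.symm (t.castLE hm))
      (fun t _ => by
        simp only [Finset.coe_filter, Finset.mem_univ, true_and, Set.mem_ofPred_eq]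
        have h1 : (α (e.symm (t.castLE hm)) : ℕ) ≤ s (e.symm (t.castLE hm)) := hs.le _
        have h2 : s (e.symm (t.castLE hm)) = t.castLE hm := e.apply_symm_apply _
        rw [h2, Fin.val_castLE] at h1
        exact lt_of_le_of_lt h1 t.2)
      (fun t _ t' _ h => Fin.castLE_injective hm (e.symm.injective h))
    simpa using h
  · intro h
    -- The first `k` cars are parked by induction; values of `s` from `k` on are irrelevant, so `id`
    -- can serve as the start.
    have step : ∀ k ≤ n, ∃ s : Fin n → Fin n, ∀ i : Fin n, (i : ℕ) < k →
        IsLeast {t : Fin n | α i ≤ t ∧ ∀ j < i, s j ≠ t} (s i) := by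
      intro k
      induction k with
      | zero => exact fun _ => ⟨id, fun i hi => absurd hi (Nat.not_lt_zero _)⟩
      | succ k ih =>
        intro hk
        obtain ⟨s, hs⟩ := ih (by omega)
        let c : Fin n := ⟨k, hk⟩
        have hne : ∃ t : Fin n, α c ≤ t ∧ ∀ j < c, s j ≠ t := by
          by_contra hfull
          push Not at hfull
          -- If car `c` cannot park, take the least `m` such that earlier cars fill all spots from
          -- `m` on. By minimality spot `m - 1`, if it exists, is free, so no car preferring a spot
          -- before `m` has passed it.
          have hex : ∃ m : ℕ, m ≤ n ∧ ∀ t : Fin n, m ≤ t → ∃ j < c, s j = t :=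
            ⟨α c, (α c).2.le, fun t ht => hfull t ht⟩
          classical
          obtain ⟨hm, hocc⟩ := Nat.find_spec hex
          have hmin := fun m => Nat.find_min hex (m := m)
          have hmc : Nat.find hex ≤ α c := Nat.find_min' hex
            ⟨(α c).2.le, fun t ht => hfull t ht⟩
          generalize Nat.find hex = m at hm hocc hmin hmc
          -- the cars parked from spot `m` on, and the car `c`, all prefer these spots
          have hpref : ∀ j < c, m ≤ (s j : ℕ) → m ≤ (α j : ℕ) := by
            intro j hj hsj
            by_contra hlt
            push Not at hlt
            refine hmin (m - 1) (by omega) ⟨by omega, fun t ht => ?_⟩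
            by_cases htm : m ≤ t
            · exact hocc t htm
            · by_contra hempty
              push Not at hempty
              have hle := (hs j hj).2 (show t ∈ {t : Fin n | α j ≤ t ∧ ∀ i < j, s i ≠ t} from
                ⟨Fin.le_def.2 (by omega), fun i hi => hempty i (hi.trans hj)⟩)
              rw [Fin.le_def] at hle
              omega
          -- The `n - m` cars in the final spots, together with `c`, leave fewer than `m` cars to
          -- prefer the first `m` spots.
          have hcount : (Finset.univ.filter fun t : Fin n => m ≤ t).card + 1 ≤
              (Finset.univ.filter fun i => ¬ (α i : ℕ) < m).card := by
            have hocc' : ∀ t : Fin n, ∃ j, m ≤ t → j < c ∧ s j = t := by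
              intro t
              by_cases ht : m ≤ t
              · obtain ⟨j, hj⟩ := hocc t ht
                exact ⟨j, fun _ => hj⟩
              · exact ⟨c, fun h => absurd h ht⟩
            choose g hg using hocc'
            have hinj : Set.InjOn g (Finset.univ.filter fun t : Fin n => m ≤ t) := by
              intro t ht t' ht' htt
              simp only [Finset.coe_filter, Finset.mem_univ, true_and, Set.mem_ofPred_eq] at ht ht'
              rw [← (hg t ht).2, ← (hg t' ht').2, htt]
            rw [← Finset.card_image_of_injOn hinj, ← Finset.card_insert_of_notMem (a := c)]
            · refine Finset.card_le_card fun i hi => ?_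
              rw [Finset.mem_insert, Finset.mem_image] at hi
              rw [Finset.mem_filter, not_lt]
              refine ⟨Finset.mem_univ i, ?_⟩
              rcases hi with rfl | ⟨t, ht, rfl⟩
              · exact hmc
              · have ht' := (Finset.mem_filter.1 ht).2
                refine hpref _ (hg t ht').1 ?_
                rw [(hg t ht').2]
                exact ht'
            · intro hc
              rw [Finset.mem_image] at hc
              obtain ⟨t, ht, hgt⟩ := hc
              exact absurd (hg t (Finset.mem_filter.1 ht).2).1 (by rw [hgt]; exact lt_irrefl c)
          have h1 := h m hm
          have h2 := Finset.card_filter_add_card_filter_not (s := (Finset.univ : Finset (Fin n)))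
            (fun i => (α i : ℕ) < m)
          have h3 := Finset.card_filter_add_card_filter_not (s := (Finset.univ : Finset (Fin n)))
            (fun t => (t : ℕ) < m)
          have h4 : (Finset.univ.filter fun t : Fin n => (t : ℕ) < m).card = m := by
            rw [Fin.card_filter_val_lt, min_eq_right hm]
          simp only [not_lt] at h2 h3 hcount
          rw [Finset.card_univ, Fintype.card_fin] at h2 h3
          omega
        have hleast : ∃ t, IsLeast {t : Fin n | α c ≤ t ∧ ∀ j < c, s j ≠ t} t := by
          have := WellFounded.has_min (wellFounded_lt (α := Fin n))
            {t : Fin n | α c ≤ t ∧ ∀ j < c, s j ≠ t} hne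
          obtain ⟨t, ht, hmin⟩ := this
          exact ⟨t, ht, fun t' ht' => not_lt.1 (hmin t' ht')⟩
        obtain ⟨t, ht⟩ := hleast
        refine ⟨Function.update s c t, fun i hi => ?_⟩
        have hset : {t' : Fin n | α i ≤ t' ∧ ∀ j < i, Function.update s c t j ≠ t'} =
            {t' : Fin n | α i ≤ t' ∧ ∀ j < i, s j ≠ t'} := by
          ext t'
          refine and_congr_right fun _ => forall₂_congr fun j hj => ?_
          have hjc : j ≠ c := by
            rintro rfl
            have := Fin.lt_def.1 hj
            simp only [c] at this
            omega
          rw [Function.update_of_ne hjc]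
        rw [hset]
        by_cases hic : i = c
        · subst hic
          rw [Function.update_self]
          exact ht
        · rw [Function.update_of_ne hic]
          refine hs i ?_
          have : (i : ℕ) ≠ k := fun h => hic (Fin.ext h)
          omega
    obtain ⟨s, hs⟩ := step n le_rfl
    exact ⟨s, fun i => hs i i.2⟩

theorem IsParkingFunction.comp_perm {n : ℕ} {α : Fin n → Fin n} (h : IsParkingFunction α)
    (σ : Perm (Fin n)) : IsParkingFunction (α ∘ σ) := by
  rw [isParkingFunction_iff] at h ⊢
  intro m hm
  refine (h m hm).trans_eq ?_
  rw [← Finset.card_map σ.symm.toEmbedding]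
  congr 1
  ext i
  simp

/-- The place action on parking functions. -/
@[reducible]
def parkingAction (n : ℕ) : MulAction (Perm (Fin n)) (PF n) where
  smul σ α := ⟨α.1 ∘ ⇑σ⁻¹, α.2.comp_perm σ⁻¹⟩
  one_smul _ := rfl
  mul_smul σ τ α := Subtype.ext (by
    change α.1 ∘ ⇑(σ * τ)⁻¹ = (α.1 ∘ ⇑τ⁻¹) ∘ ⇑σ⁻¹
    rw [mul_inv_rev]
    rfl)

theorem isPlaceAction_parkingAction (n : ℕ) : IsPlaceAction (parkingAction n) := fun _ _ => rfl

/-! ### The characteristic of the parking function module -/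

theorem sum_range_card_filter_eq {n : ℕ} (f : Fin n → ℕ) (m : ℕ) :
    ∑ v ∈ Finset.range m, (Finset.univ.filter fun i => f i = v).card =
      (Finset.univ.filter fun i => f i < m).card := by
  rw [Finset.card_eq_sum_card_fiberwise (f := f) (t := Finset.range m)]
  · refine Finset.sum_congr rfl fun v hv => ?_
    rw [Finset.mem_range] at hv
    congr 1
    ext i
    simp only [Finset.mem_filter, Finset.mem_univ, true_and]
    exact ⟨fun h => ⟨h ▸ hv, h⟩, fun h => h.2⟩
  · intro i hi
    simpa using hi

/-- The degrees of the first `m` terms add up to the number of `i` with `f i < m`; the starting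
height `1` turns the strict inequality into `m ≤`. -/
theorem isFirstPassage_ofWords_iff {n : ℕ} (f w : Fin n → ℕ) :
    IsFirstPassage (n + 1) 1 (ofWords f w) ↔
      ∀ m ≤ n, m ≤ (Finset.univ.filter fun i => f i < m).card := by
  simp only [IsFirstPassage, total_ofWords, degree_wordExponent, and_true, degree_ofWords_apply,
    sum_range_card_filter_eq]
  refine forall_congr' fun m => ?_
  rw [Nat.lt_succ_iff]
  refine forall_congr' fun _ => ?_
  omega

theorem coeff_frobeniusChar_parkingAction (n : ℕ) :
    frobeniusChar (permModule (parkingAction n)) = PowerSeries.coeff (n + 1) inverseSeries := by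
  apply Subtype.ext
  ext d
  have h := hasCount_isFirstPassage (n + 1) 1 d
  rw [pow_one] at h
  refine coeff_frobeniusChar_permModule (parkingAction n) (fun α i => (α.1 i : ℕ)) ?_
    (fun _ _ => rfl) d h fun E => ?_
  · intro α β hαβ
    apply Subtype.ext
    funext i
    exact Fin.ext (congrFun hαβ i)
  · constructor
    · rintro ⟨rfl, hE⟩
      obtain ⟨f, w, rfl⟩ := exists_ofWords_eq (n := n) E (by have := hE.2; omega)
      rw [isFirstPassage_ofWords_iff] at hE
      -- The case `m = n` of the criterion forces all letters to be legitimate spots.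
      have hf : ∀ i, f i < n := by
        have huniv : (Finset.univ.filter fun i => f i < n) = Finset.univ := by
          refine Finset.eq_univ_of_card _ (le_antisymm (Finset.card_le_univ _) ?_)
          rw [Fintype.card_fin]
          exact hE n le_rfl
        intro i
        have := Finset.mem_univ i
        rw [← huniv, Finset.mem_filter] at this
        exact this.2
      exact ⟨⟨fun i => ⟨f i, hf i⟩, (isParkingFunction_iff _).2 hE⟩, w, (total_ofWords f w).symm,
        rfl⟩
    · rintro ⟨α, w, rfl, rfl⟩
      exact ⟨total_ofWords _ _, (isFirstPassage_ofWords_iff _ _).2 ((isParkingFunction_iff _).1 α.2)⟩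

theorem X_mul_frobeniusChar_parkingAction :
    X * PowerSeries.mk (fun n => frobeniusChar (permModule (parkingAction n))) =
      inverseSeries := by
  ext n : 1
  cases n with
  | zero =>
    rw [PowerSeries.coeff_zero_X_mul, PowerSeries.coeff_zero_eq_constantCoeff_apply,
      isCompInverse_inverseSeries.2.1]
  | succ n =>
    rw [PowerSeries.coeff_succ_X_mul, PowerSeries.coeff_mk, coeff_frobeniusChar_parkingAction]

/-! ### Weak orders and unit interval parking functions -/

/-- The words whose letters form an initial segment of the natural numbers.  They encode ordered
set partitions of the positions. -/
abbrev WeakOrderWord (n : ℕ) : Type := {f : Fin n → ℕ // ∀ i, ∀ v < f i, ∃ j, f j = v}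

/-- The strict order on positions that compares the letters first. -/
def LetterLT {n : ℕ} (f : Fin n → ℕ) (j i : Fin n) : Prop := f j < f i ∨ f j = f i ∧ j < i

open Classical in
/-- The position of `i` in the standardization of the word `f`. -/
def letterRank {n : ℕ} (f : Fin n → ℕ) (i : Fin n) : Fin n :=
  ⟨(Finset.univ.filter fun j => LetterLT f j i).card, by
    conv_rhs => rw [← Fintype.card_fin n]
    refine Finset.card_lt_univ_of_notMem (x := i) fun h => ?_
    rcases (Finset.mem_filter.1 h).2 with h | h
    · exact lt_irrefl _ h
    · exact lt_irrefl _ h.2⟩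

/-- The letter at position `i` also occurs before `i`. -/
def IsRepeat {n : ℕ} (f : Fin n → ℕ) (i : Fin n) : Prop := ∃ j < i, f j = f i

open Classical in
/-- The preference list of the parking process in which the cars with the letter `v` form the
`v`-th block. -/
def blockPreference {n : ℕ} (f : Fin n → ℕ) (i : Fin n) : Fin n :=
  ⟨letterRank f i - if IsRepeat f i then 1 else 0, lt_of_le_of_lt (Nat.sub_le _ _) (letterRank f i).2⟩

/-! ### The parking process attached to a word of blocks -/

section letterRank

variable {n : ℕ} {f : Fin n → ℕ} {i j : Fin n}

theorem LetterLT.trans {k : Fin n} (h : LetterLT f i j) (h' : LetterLT f j k) :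
    LetterLT f i k := by
  rcases h with h | ⟨h1, h2⟩ <;> rcases h' with h' | ⟨h1', h2'⟩
  · exact Or.inl (h.trans h')
  · exact Or.inl (h1' ▸ h)
  · exact Or.inl (h1 ▸ h')
  · exact Or.inr ⟨h1.trans h1', h2.trans h2'⟩

theorem not_letterLT_self : ¬ LetterLT f i i := by
  rintro (h | h)
  · exact lt_irrefl _ h
  · exact lt_irrefl _ h.2

theorem letterLT_trichotomy (f : Fin n → ℕ) (i j : Fin n) :
    LetterLT f i j ∨ i = j ∨ LetterLT f j i := by
  rcases lt_trichotomy (f i) (f j) with h | h | h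
  · exact Or.inl (Or.inl h)
  · rcases lt_trichotomy i j with h' | h' | h'
    · exact Or.inl (Or.inr ⟨h, h'⟩)
    · exact Or.inr (Or.inl h')
    · exact Or.inr (Or.inr (Or.inr ⟨h.symm, h'⟩))
  · exact Or.inr (Or.inr (Or.inl h))

theorem LetterLT.letterRank_lt (h : LetterLT f j i) : letterRank f j < letterRank f i := by
  classical
  rw [Fin.lt_def]
  simp only [letterRank]
  refine Finset.card_lt_card ⟨fun k hk => ?_, fun hsub => ?_⟩
  · rw [Finset.mem_filter] at hk ⊢
    exact ⟨hk.1, hk.2.trans h⟩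
  · have := hsub (Finset.mem_filter.2 ⟨Finset.mem_univ j, h⟩)
    exact not_letterLT_self (Finset.mem_filter.1 this).2

theorem letterRank_lt_iff : letterRank f j < letterRank f i ↔ LetterLT f j i := by
  refine ⟨fun h => ?_, LetterLT.letterRank_lt⟩
  rcases letterLT_trichotomy f j i with h' | rfl | h'
  · exact h'
  · exact absurd h (lt_irrefl _)
  · exact absurd h h'.letterRank_lt.asymm

theorem letterRank_injective (f : Fin n → ℕ) : Function.Injective (letterRank f) := by
  intro i j h
  rcases letterLT_trichotomy f i j with h' | h' | h'
  · exact absurd h h'.letterRank_lt.ne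
  · exact h'
  · exact absurd h h'.letterRank_lt.ne'

theorem le_of_letterRank_le (h : letterRank f j ≤ letterRank f i) : f j ≤ f i := by
  rcases h.lt_or_eq with h | h
  · rcases letterRank_lt_iff.1 h with h | h
    · exact h.le
    · exact h.1.le
  · rw [letterRank_injective f h]

theorem IsRepeat.letterRank_pos (h : IsRepeat f i) : 0 < (letterRank f i : ℕ) := by
  obtain ⟨j, hj, hf⟩ := h
  exact lt_of_le_of_lt (Nat.zero_le _) (Fin.lt_def.1 (LetterLT.letterRank_lt (Or.inr ⟨hf, hj⟩)))

theorem blockPreference_of_isRepeat (h : IsRepeat f i) :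
    (blockPreference f i : ℕ) + 1 = letterRank f i := by
  have := h.letterRank_pos
  simp only [blockPreference, if_pos h]
  omega

theorem blockPreference_of_not_isRepeat (h : ¬ IsRepeat f i) :
    blockPreference f i = letterRank f i := by
  apply Fin.ext
  simp only [blockPreference, if_neg h, Nat.sub_zero]

theorem blockPreference_eq_iff : blockPreference f i = letterRank f i ↔ ¬ IsRepeat f i := by
  refine ⟨fun h hr => ?_, blockPreference_of_not_isRepeat⟩
  have := blockPreference_of_isRepeat hr
  rw [h] at this
  omega

/-- The spot before that of a repeated letter belongs to an earlier occurrence of this letter. -/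
theorem IsRepeat.eq_of_letterRank_succ (h : IsRepeat f i)
    (hj : (letterRank f j : ℕ) + 1 = letterRank f i) : f j = f i ∧ j < i := by
  obtain ⟨m, hm, hf⟩ := h
  have h1 : letterRank f m < letterRank f i := LetterLT.letterRank_lt (Or.inr ⟨hf, hm⟩)
  have h2 : letterRank f m ≤ letterRank f j := by
    rw [Fin.lt_def] at h1
    rw [Fin.le_def]
    omega
  have h3 : f i ≤ f j := hf ▸ le_of_letterRank_le h2
  rcases letterRank_lt_iff.1 (show letterRank f j < letterRank f i by rw [Fin.lt_def]; omega)
    with h | h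
  · exact absurd h h3.not_gt
  · exact h

theorem blockPreference_le_letterRank : (blockPreference f i : ℕ) ≤ letterRank f i := by
  by_cases h : IsRepeat f i
  · have := blockPreference_of_isRepeat h
    omega
  · rw [blockPreference_of_not_isRepeat h]

theorem letterRank_le_blockPreference_succ : (letterRank f i : ℕ) ≤ blockPreference f i + 1 := by
  by_cases h : IsRepeat f i
  · have := blockPreference_of_isRepeat h
    omega
  · rw [blockPreference_of_not_isRepeat h]
    omega

theorem letterRank_surjective (f : Fin n → ℕ) : Function.Surjective (letterRank f) :=
  Finite.injective_iff_surjective.1 (letterRank_injective f)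

/-- A first occurrence gets its preferred spot. A repeated letter prefers the spot of the preceding
occurrence, already taken by an earlier car, and moves on by one. -/
theorem parksAt_letterRank (f : Fin n → ℕ) : ParksAt (blockPreference f) (letterRank f) := by
  intro i
  refine ⟨⟨blockPreference_le_letterRank, fun j hj h => ?_⟩, ?_⟩
  · exact hj.ne (letterRank_injective f h)
  · rintro t ⟨ht, hfree⟩
    by_contra hlt
    rw [not_le, Fin.lt_def] at hlt
    rw [Fin.le_def] at ht
    by_cases h : IsRepeat f i
    · have h1 := blockPreference_of_isRepeat h
      obtain ⟨j, rfl⟩ := letterRank_surjective f t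
      exact hfree j (h.eq_of_letterRank_succ (by omega)).2 rfl
    · rw [blockPreference_of_not_isRepeat h] at ht
      omega

theorem isUnitIntervalParkingFunction_blockPreference (f : Fin n → ℕ) :
    IsUnitIntervalParkingFunction (blockPreference f) :=
  ⟨letterRank f, parksAt_letterRank f, fun _ => letterRank_le_blockPreference_succ⟩

/-- Listing the cars by rank sorts their preferences, since each preference is the rank or one less
and the ranks are distinct. -/
theorem sortedWord_letterRank (f : Fin n → ℕ) (i : Fin n) :
    sortedWord (blockPreference f) (letterRank f i) = blockPreference f i := by
  let e := Equiv.ofBijective (letterRank f) ⟨letterRank_injective f, letterRank_surjective f⟩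
  have hmono : Monotone (blockPreference f ∘ e.symm) := by
    intro k l hkl
    rcases hkl.lt_or_eq with hlt | rfl
    · have h1 := blockPreference_le_letterRank (f := f) (i := e.symm k)
      have h2 := letterRank_le_blockPreference_succ (f := f) (i := e.symm l)
      have h3 : letterRank f (e.symm k) = k := e.apply_symm_apply k
      have h4 : letterRank f (e.symm l) = l := e.apply_symm_apply l
      rw [h3] at h1
      rw [h4] at h2
      rw [Fin.le_def, Function.comp_apply, Function.comp_apply]
      rw [Fin.lt_def] at hlt
      omega
    · exact le_rfl
  rw [sortedWord, ← Tuple.comp_sort_eq_comp_iff_monotone.2 hmono, Function.comp_apply]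
  exact congrArg _ (e.symm_apply_apply i)

/-- The block starts are the ranks of first occurrences of letters. Those up to the rank of `i`
belong to the letters `0, …, f i`, all of which occur by `hf`. -/
theorem blockNumber_letterRank (hf : ∀ i, ∀ v < f i, ∃ j, f j = v) (i : Fin n) :
    blockNumber (blockPreference f) (letterRank f i) = f i + 1 := by
  rw [blockNumber, ← Finset.card_range (f i + 1)]
  symm
  have hfirst : ∀ v, ∃ j, v ≤ f i → f j = v ∧ ¬ IsRepeat f j ∧ (v = f i → j ≤ i) := by
    intro v
    by_cases hv : v ≤ f i
    · have hne : {j | f j = v}.Nonempty := by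
        rcases hv.lt_or_eq with h | h
        · exact hf i v h
        · exact ⟨i, h.symm⟩
      obtain ⟨j, hj, hmin⟩ := WellFounded.has_min (wellFounded_lt (α := Fin n)) _ hne
      refine ⟨j, fun _ => ⟨hj, ?_, fun h => not_lt.1 (hmin i h.symm)⟩⟩
      rintro ⟨m, hm, hmj⟩
      exact hmin m (hmj.trans hj) hm
    · exact ⟨i, fun h => absurd h hv⟩
  choose g hg using hfirst
  refine Finset.card_bij (fun v _ => letterRank f (g v)) ?_ ?_ ?_
  · intro v hv
    rw [Finset.mem_range, Nat.lt_succ_iff] at hv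
    obtain ⟨h1, h2, h3⟩ := hg v hv
    rw [Finset.mem_filter]
    refine ⟨Finset.mem_univ _, ?_, ?_⟩
    · by_contra hlt
      rw [not_le, letterRank_lt_iff] at hlt
      rcases hlt with h | h
      · omega
      · exact absurd (h3 (by omega)) h.2.not_ge
    · rw [sortedWord_letterRank, blockPreference_of_not_isRepeat h2]
  · intro v hv v' hv' h
    rw [Finset.mem_range, Nat.lt_succ_iff] at hv hv'
    rw [← (hg v hv).1, ← (hg v' hv').1, letterRank_injective f h]
  · intro l hl
    obtain ⟨j, rfl⟩ := letterRank_surjective f l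
    rw [Finset.mem_filter, sortedWord_letterRank, blockPreference_eq_iff] at hl
    obtain ⟨-, hle, hj⟩ := hl
    have hv : f j ≤ f i := le_of_letterRank_le hle
    refine ⟨f j, Finset.mem_range.2 (Nat.lt_succ_of_le hv), ?_⟩
    obtain ⟨h1, h2, -⟩ := hg (f j) hv
    congr 1
    rcases lt_trichotomy (g (f j)) j with h | h | h
    · exact absurd ⟨_, h, h1⟩ hj
    · exact h
    · exact absurd ⟨_, h, h1.symm⟩ h2

/-- Two cars with the same preference have ranks differing by at most one; if they differ, the later
spot belongs to a repeated letter, whose predecessor carries the same letter. -/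
theorem eq_of_blockPreference_eq (h : blockPreference f i = blockPreference f j) : f i = f j := by
  wlog hij : letterRank f i ≤ letterRank f j generalizing i j
  · exact (this h.symm (le_of_not_ge hij)).symm
  rcases hij.lt_or_eq with hlt | heq
  · have h1 := blockPreference_le_letterRank (f := f) (i := i)
    rw [Fin.lt_def] at hlt
    rw [h] at h1
    have h2 := letterRank_le_blockPreference_succ (f := f) (i := j)
    have hr : IsRepeat f j := by
      by_contra hnot
      rw [blockPreference_of_not_isRepeat hnot] at h1
      omega
    exact (hr.eq_of_letterRank_succ (by omega)).1
  · rw [letterRank_injective f heq]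

theorem sameBlock_blockPreference_iff (hf : ∀ i, ∀ v < f i, ∃ j, f j = v) (i j : Fin n) :
    SameBlock (blockPreference f) (blockPreference f i) (blockPreference f j) ↔ f i = f j := by
  constructor
  · rintro ⟨k, l, hk, hl, hkl⟩
    obtain ⟨a, rfl⟩ := letterRank_surjective f k
    obtain ⟨b, rfl⟩ := letterRank_surjective f l
    rw [sortedWord_letterRank] at hk hl
    rw [blockNumber_letterRank hf, blockNumber_letterRank hf] at hkl
    rw [← eq_of_blockPreference_eq hk, ← eq_of_blockPreference_eq hl]
    omega
  · intro h
    refine ⟨letterRank f i, letterRank f j, sortedWord_letterRank f i, sortedWord_letterRank f j, ?_⟩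
    rw [blockNumber_letterRank hf, blockNumber_letterRank hf, h]

/-- Exchanging neighbouring positions reverses the order of no other pair, and this pair has
different letters, so the order among equal letters is preserved. Rank and repetition depend on
positions only through that order. -/
theorem blockPreference_comp_swap {i j : Fin n} (hij : (j : ℕ) = (i : ℕ) + 1) (hne : f i ≠ f j) :
    blockPreference (f ∘ Equiv.swap i j) = blockPreference f ∘ Equiv.swap i j := by
  classical
  have hlt : ∀ a b, f (Equiv.swap i j a) = f (Equiv.swap i j b) →
      (a < b ↔ Equiv.swap i j a < Equiv.swap i j b) := by
    intro a b hab
    by_cases hai : a = i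
    · subst hai
      by_cases hbj : b = j
      · subst hbj
        rw [Equiv.swap_apply_left, Equiv.swap_apply_right] at hab
        exact absurd hab.symm hne
      · by_cases hba : b = a
        · simp [hba]
        · rw [Equiv.swap_apply_left, Equiv.swap_apply_of_ne_of_ne hba hbj]
          rw [Fin.lt_def, Fin.lt_def]
          have := Fin.val_ne_of_ne hba
          have := Fin.val_ne_of_ne hbj
          omega
    · by_cases haj : a = j
      · subst haj
        by_cases hbi : b = i
        · subst hbi
          rw [Equiv.swap_apply_left, Equiv.swap_apply_right] at hab
          exact absurd hab hne
        · by_cases hba : b = a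
          · simp [hba]
          · rw [Equiv.swap_apply_right, Equiv.swap_apply_of_ne_of_ne hbi hba]
            rw [Fin.lt_def, Fin.lt_def]
            have := Fin.val_ne_of_ne hba
            have := Fin.val_ne_of_ne hbi
            omega
      · rw [Equiv.swap_apply_of_ne_of_ne hai haj]
        have := Fin.val_ne_of_ne hai
        have := Fin.val_ne_of_ne haj
        by_cases hbi : b = i
        · subst hbi
          rw [Equiv.swap_apply_left, Fin.lt_def, Fin.lt_def]
          omega
        · by_cases hbj : b = j
          · subst hbj
            rw [Equiv.swap_apply_right, Fin.lt_def, Fin.lt_def]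
            omega
          · rw [Equiv.swap_apply_of_ne_of_ne hbi hbj]
  have hletter : ∀ a b, LetterLT (f ∘ Equiv.swap i j) a b ↔
      LetterLT f (Equiv.swap i j a) (Equiv.swap i j b) := fun a b =>
    or_congr Iff.rfl (and_congr_right fun h => hlt a b h)
  funext b
  have hrank : letterRank (f ∘ Equiv.swap i j) b = letterRank f (Equiv.swap i j b) := by
    apply Fin.ext
    simp only [letterRank]
    refine Finset.card_equiv (Equiv.swap i j) fun a => ?_
    simp only [Finset.mem_filter, Finset.mem_univ, true_and]
    exact hletter a b
  have hrepeat : IsRepeat (f ∘ Equiv.swap i j) b ↔ IsRepeat f (Equiv.swap i j b) := by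
    constructor
    · rintro ⟨a, hab, h⟩
      exact ⟨Equiv.swap i j a, (hlt a b h).1 hab, h⟩
    · rintro ⟨a, hab, h⟩
      refine ⟨Equiv.swap i j a, (hlt _ b ?_).2 ?_, ?_⟩ <;>
        simpa only [Function.comp_apply, Equiv.swap_apply_self] using by assumption
  apply Fin.ext
  simp only [blockPreference, Function.comp_apply, hrank, hrepeat]

end letterRank

/-- Every unit interval parking function arises from a word of blocks. -/
theorem exists_blockPreference_eq {n : ℕ} {α : Fin n → Fin n}
    (h : IsUnitIntervalParkingFunction α) :
    ∃ f : Fin n → ℕ, (∀ i, ∀ v < f i, ∃ j, f j = v) ∧ blockPreference f = α := by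
  classical
  obtain ⟨s, hs, hunit⟩ := h
  have hle : ∀ i, (α i : ℕ) ≤ s i := fun i => hs.le i
  -- Lucky cars, those parking where they prefer, open the blocks. Counting them up to spot `s i`,
  -- without the one in spot `0`, numbers the blocks from `0`.
  let S : Fin n → Finset (Fin n) := fun i =>
    Finset.univ.filter fun j => α j = s j ∧ 0 < (s j : ℕ) ∧ s j ≤ s i
  let f : Fin n → ℕ := fun i => (S i).card
  have hS : ∀ i j, j ∈ S i ↔ α j = s j ∧ 0 < (s j : ℕ) ∧ s j ≤ s i := fun i j => by simp [S]
  have hmono : ∀ i j, s i ≤ s j → f i ≤ f j := by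
    intro i j hij
    refine Finset.card_le_card fun k hk => ?_
    rw [hS] at hk ⊢
    exact ⟨hk.1, hk.2.1, hk.2.2.trans hij⟩
  have hpred : ∀ j, 0 < (s j : ℕ) → ∃ i, (s j : ℕ) = s i + 1 := by
    intro j hj
    obtain ⟨i, hi⟩ := hs.surjective ⟨(s j : ℕ) - 1, by omega⟩
    refine ⟨i, ?_⟩
    rw [hi]
    simp only
    omega
  have hSucc : ∀ i j, (s j : ℕ) = s i + 1 → ∀ k, k ∈ S j ↔ (k = j ∧ α j = s j) ∨ k ∈ S i := by
    intro i j hij k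
    rw [hS, hS]
    constructor
    · rintro ⟨h1, h2, h3⟩
      rcases h3.lt_or_eq with h | h
      · exact Or.inr ⟨h1, h2, by rw [Fin.lt_def] at h; rw [Fin.le_def]; omega⟩
      · have := hs.injective h
        subst this
        exact Or.inl ⟨rfl, h1⟩
    · rintro (⟨rfl, h⟩ | ⟨h1, h2, h3⟩)
      · exact ⟨h, by omega, le_rfl⟩
      · exact ⟨h1, h2, by rw [Fin.le_def] at h3 ⊢; omega⟩
  have hlucky : ∀ i j, (s j : ℕ) = s i + 1 → α j = s j → f j = f i + 1 := by
    intro i j hij hj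
    have h1 : S j = insert j (S i) := by
      ext k
      rw [hSucc i j hij, Finset.mem_insert]
      simp [hj]
    have h2 : j ∉ S i := by
      rw [hS]
      rintro ⟨-, -, h⟩
      rw [Fin.le_def] at h
      omega
    simp only [f]
    rw [h1, Finset.card_insert_of_notMem h2]
  -- An unlucky car prefers the spot just before its own, so the car in that spot must have arrived
  -- earlier.
  have hunlucky : ∀ i j, (s j : ℕ) = s i + 1 → α j ≠ s j → f j = f i ∧ i < j := by
    intro i j hij hj
    constructor
    · simp only [f]
      congr 1
      ext k
      rw [hSucc i j hij]
      simp [hj]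
    · by_contra hnot
      have hαj : (α j : ℕ) ≠ s j := fun h => hj (Fin.ext h)
      have := hle j
      have := hunit j
      have hmem : s i ∈ {t : Fin n | α j ≤ t ∧ ∀ k < j, s k ≠ t} := by
        refine ⟨?_, fun k hk h => hnot (hs.injective h ▸ hk)⟩
        rw [Fin.le_def]
        omega
      have := Fin.le_def.1 ((hs j).2 hmem)
      omega
  have hstrict : ∀ i j, s i < s j → α j = s j → f i < f j := by
    intro i j hij hj
    obtain ⟨k, hk⟩ := hpred j (lt_of_le_of_lt (Nat.zero_le _) (Fin.lt_def.1 hij))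
    rw [hlucky k j hk hj, Nat.lt_succ_iff]
    refine hmono i k ?_
    rw [Fin.lt_def] at hij
    rw [Fin.le_def]
    omega
  -- Within a block, cars stand in their order of arrival: chain `hunlucky` backwards from spot `s
  -- j`.
  have hsame : ∀ m : ℕ, ∀ i j, (s j : ℕ) = m → s i < s j → f i = f j → i < j := by
    intro m
    induction m with
    | zero =>
      intro i j hj hij
      rw [Fin.lt_def] at hij
      omega
    | succ m ih =>
      intro i j hj hij hf
      have hju : α j ≠ s j := fun h => (hstrict i j hij h).ne hf
      obtain ⟨k, hk⟩ := hpred j (by omega)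
      obtain ⟨h1, h2⟩ := hunlucky k j hk hju
      rw [Fin.lt_def] at hij
      by_cases hik : i = k
      · exact hik ▸ h2
      · have hne : (s i : ℕ) ≠ s k := fun h => hik (hs.injective (Fin.ext h))
        exact (ih i k (by omega) (by rw [Fin.lt_def]; omega) (hf.trans h1)).trans h2
  have hlt : ∀ i j, s i < s j → LetterLT f i j := by
    intro i j hij
    rcases (hmono i j hij.le).lt_or_eq with h | h
    · exact Or.inl h
    · exact Or.inr ⟨h, hsame _ i j rfl hij h⟩
  have hiff : ∀ i j, LetterLT f i j ↔ s i < s j := by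
    refine fun i j => ⟨fun h => ?_, hlt i j⟩
    rcases lt_trichotomy (s i) (s j) with h' | h' | h'
    · exact h'
    · rw [hs.injective h'] at h
      exact absurd h not_letterLT_self
    · exact absurd (h.trans (hlt j i h')) not_letterLT_self
  have hrank : ∀ i, letterRank f i = s i := by
    intro i
    apply Fin.ext
    simp only [letterRank, hiff]
    rw [Finset.card_equiv (Equiv.ofBijective s ⟨hs.injective, hs.surjective⟩)
      (t := Finset.univ.filter fun t : Fin n => (t : ℕ) < s i) (fun j => by
        simp only [Finset.mem_filter, Finset.mem_univ, true_and]
        exact Iff.rfl)]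
    rw [Fin.card_filter_val_lt, min_eq_right (s i).2.le]
  refine ⟨f, ?_, ?_⟩
  · have hdown : ∀ m : ℕ, ∀ i, (s i : ℕ) = m → ∀ v < f i, ∃ j, f j = v := by
      intro m
      induction m with
      | zero =>
        intro i hi v hv
        have h0 : S i = ∅ := by
          rw [Finset.eq_empty_iff_forall_notMem]
          intro k hk
          rw [hS, Fin.le_def] at hk
          omega
        simp [f, h0] at hv
      | succ m ih =>
        intro i hi v hv
        obtain ⟨k, hk⟩ := hpred i (by omega)
        by_cases hl : α i = s i
        · rw [hlucky k i hk hl, Nat.lt_succ_iff] at hv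
          rcases hv.lt_or_eq with h | h
          · exact ih k (by omega) v h
          · exact ⟨k, h.symm⟩
        · rw [(hunlucky k i hk hl).1] at hv
          exact ih k (by omega) v hv
    exact fun i => hdown _ i rfl
  · funext i
    by_cases hr : IsRepeat f i
    · have h1 := blockPreference_of_isRepeat hr
      rw [hrank] at h1
      have h2 : α i ≠ s i := by
        intro hl
        obtain ⟨j, hj, hf⟩ := hr
        exact (hstrict j i ((hiff j i).1 (Or.inr ⟨hf, hj⟩)) hl).ne hf
      have h3 : (α i : ℕ) ≠ s i := fun h => h2 (Fin.ext h)
      have := hle i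
      have := hunit i
      apply Fin.ext
      omega
    · rw [blockPreference_of_not_isRepeat hr, hrank]
      by_contra hl
      have h3 : (α i : ℕ) ≠ s i := fun h => hl (Fin.ext h.symm)
      have := hle i
      obtain ⟨k, hk⟩ := hpred i (by omega)
      obtain ⟨h1, h2⟩ := hunlucky k i hk (Ne.symm hl)
      exact hr ⟨k, h2, h1.symm⟩

/-- Unit interval parking functions correspond to ordered set partitions. -/
def weakOrderEquiv (n : ℕ) : WeakOrderWord n ≃ UPF n :=
  Equiv.ofBijective
    (fun f => ⟨blockPreference f.1, isUnitIntervalParkingFunction_blockPreference f.1⟩) (by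
    constructor
    · intro f f' h
      have hα : blockPreference f.1 = blockPreference f'.1 := Subtype.ext_iff.1 h
      have hs : letterRank f.1 = letterRank f'.1 := by
        refine (parksAt_letterRank f.1).unique ?_
        rw [hα]
        exact parksAt_letterRank f'.1
      apply Subtype.ext
      funext i
      -- The preferences determine the spots, and the block numbers at these spots recover the word.
      have h1 := blockNumber_letterRank f.2 i
      rw [hα, hs, blockNumber_letterRank f'.2] at h1
      omega
    · rintro ⟨α, hα⟩
      obtain ⟨f, hf, rfl⟩ := exists_blockPreference_eq hα
      exact ⟨⟨f, hf⟩, rfl⟩)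

theorem weakOrderEquiv_apply {n : ℕ} (f : WeakOrderWord n) :
    (weakOrderEquiv n f).1 = blockPreference f.1 := rfl

/-- The place action on ordered set partitions. -/
@[reducible]
def weakOrderAction (n : ℕ) : MulAction (Perm (Fin n)) (WeakOrderWord n) where
  smul σ f := ⟨f.1 ∘ ⇑σ⁻¹, fun i v hv => by
    obtain ⟨j, hj⟩ := f.2 (σ⁻¹ i) v hv
    exact ⟨σ j, by rw [← hj]; simp⟩⟩
  one_smul _ := rfl
  mul_smul σ τ f := Subtype.ext (by
    change f.1 ∘ ⇑(σ * τ)⁻¹ = (f.1 ∘ ⇑τ⁻¹) ∘ ⇑σ⁻¹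
    rw [mul_inv_rev]
    rfl)

/-- The action on unit interval parking functions that corresponds to the place action on ordered
set partitions. -/
@[reducible]
def unitIntervalAction (n : ℕ) : MulAction (Perm (Fin n)) (UPF n) :=
  letI := weakOrderAction n
  (weakOrderEquiv n).symm.mulAction (Perm (Fin n))

theorem unitIntervalAction_smul {n : ℕ} (σ : Perm (Fin n)) (α : UPF n) :
    (unitIntervalAction n).smul σ α =
      weakOrderEquiv n ((weakOrderAction n).smul σ ((weakOrderEquiv n).symm α)) := rfl

/-- On words of blocks the swap acts by places. It does nothing when the two letters agree, and
otherwise commutes with `blockPreference`. -/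
theorem isBlockAction_unitIntervalAction (n : ℕ) : IsBlockAction (unitIntervalAction n) := by
  classical
  intro i j hij α
  obtain ⟨f, rfl⟩ := (weakOrderEquiv n).surjective α
  have hsmul : ((unitIntervalAction n).smul (Equiv.swap i j) (weakOrderEquiv n f)).1 =
      blockPreference (f.1 ∘ Equiv.swap i j) := by
    rw [unitIntervalAction_smul, Equiv.symm_apply_apply, weakOrderEquiv_apply]
    change blockPreference (f.1 ∘ ⇑(Equiv.swap i j)⁻¹) = _
    rw [Equiv.swap_inv]
  rw [hsmul, weakOrderEquiv_apply]
  by_cases h : f.1 i = f.1 j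
  · rw [if_pos ((sameBlock_blockPreference_iff f.2 i j).2 h)]
    congr 1
    funext k
    rw [Function.comp_apply, Equiv.swap_apply_def]
    split_ifs with h1 h2
    · rw [h1, h]
    · rw [h2, h]
    · rfl
  · rw [if_neg fun hs => h ((sameBlock_blockPreference_iff f.2 i j).1 hs),
      blockPreference_comp_swap hij h]

/-! ### The characteristic of the unit interval module -/

theorem isGapless_ofWords_iff {n : ℕ} (f w : Fin n → ℕ) :
    IsGapless (ofWords f w) ↔ ∀ i, ∀ v < f i, ∃ j, f j = v := by
  simp only [IsGapless, ofWords_apply_ne_zero_iff]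
  constructor
  · intro h i v hv
    obtain ⟨k, hk⟩ := Nat.exists_eq_add_of_lt hv
    clear hv
    induction k generalizing v with
    | zero => exact h v ⟨i, hk⟩
    | succ k ih => exact h v (ih (v + 1) (by omega))
  · rintro h v ⟨i, hi⟩
    exact h i v (by omega)

theorem exists_hasGradedCoeff_frobeniusChar :
    ∃ N : (ℕ →₀ ℕ) → ℂ, HasGradedCoeff
      (PowerSeries.mk fun n => frobeniusChar (permModule (unitIntervalAction n))) N ∧
      N 0 = 1 ∧ ∀ d ≠ 0, 2 * N d = ∑ p ∈ Finset.HasAntidiagonal.antidiagonal d, N p.2 := by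
  obtain ⟨N, hN, h0, hrec⟩ := exists_hasCount_isGapless
  refine ⟨N, fun n d => ?_, h0, hrec⟩
  rw [PowerSeries.coeff_mk]
  -- Including `d.degree = n` in the property makes the count vanish off the diagonal, where no word
  -- of length `n` has exponent `d`.
  have hcount : HasCount (fun E => d.degree = n ∧ total E = d ∧ IsGapless E)
      (if d.degree = n then N d else 0) := by
    split_ifs with h
    · exact (hN d).congr fun E => by simp [h]
    · exact hasCount_false fun E hE => h hE.1
  refine coeff_frobeniusChar_permModule (unitIntervalAction n)
    (fun α => ((weakOrderEquiv n).symm α).1)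
    (fun α β h => (weakOrderEquiv n).symm.injective (Subtype.ext h)) (fun σ α => ?_) d hcount
    fun E => ?_
  · rw [unitIntervalAction_smul, Equiv.symm_apply_apply]
    rfl
  · constructor
    · rintro ⟨hd, rfl, hE⟩
      obtain ⟨f, w, rfl⟩ := exists_ofWords_eq E hd
      refine ⟨weakOrderEquiv n ⟨f, (isGapless_ofWords_iff f w).1 hE⟩, w,
        (total_ofWords f w).symm, ?_⟩
      rw [Equiv.symm_apply_apply]
    · rintro ⟨α, w, rfl, rfl⟩
      exact ⟨degree_wordExponent w, total_ofWords _ _,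
        (isGapless_ofWords_iff _ _).2 ((weakOrderEquiv n).symm α).2⟩

/-- Multiplication by `H` sums `N` over all exponents below `d`. For `d ≠ 0` the recursion makes
this equal to `2 * N d`, and for `d = 0` the difference is `2 - 1`. -/
theorem two_sub_genH_mul_frobeniusChar :
    (2 - genH) * (PowerSeries.mk fun n => frobeniusChar (permModule (unitIntervalAction n))) =
      1 := by
  obtain ⟨N, hU, h0, hrec⟩ := exists_hasGradedCoeff_frobeniusChar
  have h := (hU.add hU).sub (hasGradedCoeff_genH.mul hU)
  rw [← two_mul, ← sub_mul] at h
  refine h.unique ?_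
  convert hasGradedCoeff_one using 2 with d
  simp only [one_mul]
  by_cases hd : d = 0
  · subst hd
    simp [h0]
  · rw [if_neg hd, ← hrec d hd]
    ring

end

theorem mainTheorem2 :
    ∃ (actPF : ∀ n : ℕ, MulAction (Perm (Fin n)) (PF n))
      (actUPF : ∀ n : ℕ, MulAction (Perm (Fin n)) (UPF n)),
      (∀ n, IsPlaceAction (actPF n)) ∧ (∀ n, IsBlockAction (actUPF n)) ∧
      IsCompInverse (X * PowerSeries.rescale (-1) genE)
        (X * PowerSeries.mk fun n => frobeniusChar (permModule (actPF n))) ∧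
      (2 - genH) * (PowerSeries.mk fun n => frobeniusChar (permModule (actUPF n))) = 1 := by
  refine ⟨parkingAction, unitIntervalAction, isPlaceAction_parkingAction,
    isBlockAction_unitIntervalAction, ?_, two_sub_genH_mul_frobeniusChar⟩
  rw [X_mul_frobeniusChar_parkingAction]
  exact isCompInverse_inverseSeries
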